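/- **Setting.** Let $N,M\ge 1$ and $\kappa\in\mathbb C\setminus\{0\}$, put $K=\kappa^N$, $\omega=e^{2\pi i/N}$, $\omega^{1/2}=e^{i\pi/N}$, and assume that $\cos^2(j\pi/M)+K\neq 0$ for $0\le j<M$. With the principal square root define, for $\phi\in\mathbb C$, $$\Delta(\phi)=e^{i\phi}\bigl(\sqrt{\cos^2\phi+K}+\cos\phi\bigr),\quad \Delta^*(\phi)=e^{-i\phi}\bigl(\sqrt{\cos^2\phi+K}+\cos\phi\bigr),\quad \Lambda(\phi)=\Delta(\phi)\Delta^*(\phi),$$ $$d(\phi,\phi')=\frac{(\Delta(\phi)-\Delta(\phi'))(\Delta^*(\phi)-\Delta^*(\phi'))}{(\Delta(\phi)-\Delta^*(\phi'))(\Delta^*(\phi)-\Delta(\phi'))},\quad c(\phi)=\frac{\Delta^*(\phi)}{\Delta(\phi)}\,\frac{1-\Delta(\phi)}{1-\Delta^*(\phi)},\quad s(\phi,\phi')=\frac{\Delta^*(\phi)}{\Delta(\phi)}\,\frac{\Delta^*(\phi')-\Delta(\phi)}{\Delta^*(\phi')-\Delta^*(\phi)} .$$ The allowed phases are $\pi/M,2\pi/M,\dots,(M-1)\pi/M$.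 For amplitudes $f_k\in\mathbb C$ and phases $\phi_k$ put $T^{(0)}_m=1$, $$T^{(n)}_m(\{f_k,\phi_k\}_{k=1}^{n})=T^{(n-1)}_m(\{f_k,\phi_k\}_{k=1}^{n-1})+f_n e^{2im\phi_n}\,T^{(n-1)}_m(\{d(\phi_k,\phi_n)f_k,\phi_k\}_{k=1}^{n-1}),$$ and $\Theta^{(n)}_m(\{f_k,\phi_k\})=T^{(n)}_m(\{c(\phi_k)f_k,\phi_k\})$. An $n$-solitonic state with data $\{f_k,\phi_k\}_{k=1}^n$ (distinct allowed phases) consists of nonzero numbers $\tau_m,\theta_m$, $m\in\mathbb Z/M$, with $\tau_m^N=T^{(n)}_m$, $\theta_m^N=\Theta^{(n)}_m$; in particular it exists only if no $T^{(n)}_m$ and no $\Theta^{(n)}_m$ vanishes. Its chain parameters are $u_m=-\omega^{-1/2}\tau_{m-1}/\tau_m$, $w_m=-\theta_m/\theta_{m-1}$, $m=1,\dots,M$. For $\Lambda\ne0$ let $$L(U,W)=\begin{pmatrix}1+\frac{K}{\Lambda}UW&\frac U\Lambda\\ W&0\end{pmatrix},\qquad \widetilde L_\phi(U,W)=\begin{pmatrix}1+K_\phi\frac{\Lambda_\phi}{\Lambda}W&\frac{U}{\Lambda}(1+K_\phi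 W)\\ \Lambda_\phi\frac WU&W\end{pmatrix},\qquad \Lambda_\phi=\Lambda(\phi),\quad K_\phi=\frac{K}{\Delta(\phi)} .$$ A *cyclic solution with spectral parameter $\phi$* takes a chain $(u_m,w_m)_{m=1}^M$ to a chain $(u'_m,w'_m)_{m=1}^M$ if there are nonzero $u_{\phi,m},w_{\phi,m}$, $1\le m\le M+1$, such that, identically in $\Lambda$ and for $m=1,\dots,M$, $$\widetilde L_\phi(u_{\phi,m}^N,w_{\phi,m}^N)\,L(u_m^N,w_m^N)=L(u_m'^N,w_m'^N)\,\widetilde L_\phi(u_{\phi,m+1}^N,w_{\phi,m+1}^N),$$ and $u_{\phi,M+1}=u_{\phi,1}$, $w_{\phi,M+1}=w_{\phi,1}$. Chains are compared with states up to the phases of $u'_m,w'_m$, i.e. through $u_m'^N,w_m'^N$. A chain is in a state *up to the gauge multiplier* $C$ if $u_m'^N$ is $C$ times, and $w_m'^N$ is $C^{-1}$ times, the value for the state, for all $m$. **Proposition 3.** Let the chain $(u_m,w_m)$ be in the $n$-solitonic state with data $\{f_k,\phi_k\}_{k=1}^n$. * **(a)** Let $\phi$ be an allowed phase, $\phi\notin\{\phi_k\}_{k=1}^n$.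 The chains $(u',w')$ produced by cyclic solutions with spectral parameter $\phi$ are exactly those in an $(n+1)$-solitonic state with data $\{f'_k,\phi_k\}_{k=1}^{n+1}$, where $f_k'=f_k\,s(\phi_k,\phi)$ for $k\le n$, $\phi_{n+1}=\phi$ and $f'_{n+1}$ is an arbitrary complex number (for which the state exists), together with the limiting case "$f'_{n+1}=\infty$": those which are, up to the gauge multiplier $\Delta^*(\phi)/\Delta(\phi)$, in an $n$-solitonic state with data $\{f_k\,s(\phi_k,-\phi),\phi_k\}_{k=1}^n$. * **(b)** Let $\phi\in\mathbb C$ with $e^{2iM\phi}\ne1$, or $\phi\in\pi\mathbb Z$. The chains $(u',w')$ produced by cyclic solutions with spectral parameter $\phi$ are exactly those in an $n$-solitonic state with data $\{f_k\,s(\phi_k,\phi),\phi_k\}_{k=1}^n$ (the formulae of (a) with $f'_{n+1}=0$), together with those of the other branch $-\phi$, for which $\Lambda(-\phi)=\Lambda(\phi)$: up to the gauge multiplier $\Delta^*(\phi)/\Delta(\phi)$ they are in an $n$-solitonic state with data $\{f_k\,s(\phi_k,-\phi),\phi_k\}_{k=1}^n$. * **(c)** Let $\phi=-\phi_j$ for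 some $j\le n$ with $f_j\ne0$. Then $s(\phi_j,\phi)=0$, and the chains $(u',w')$ produced by cyclic solutions with spectral parameter $\phi$ are exactly those in an $(n-1)$-solitonic state with data $\{f_k\,s(\phi_k,\phi),\phi_k\}_{k\ne j}$. * **(d)** Let $\phi=\phi_j$ for some $j\le n$ with $f_j\neq0$. The chains $(u',w')$ produced by cyclic solutions with spectral parameter $\phi$ are exactly those which are, up to the gauge multiplier $\Delta^*(\phi)/\Delta(\phi)$, in an $(n-1)$-solitonic state with data $\{f_k\,s(\phi_k,\phi)\,d(\phi_k,\phi),\phi_k\}_{k\neq j}$. Moreover every nonzero $\Lambda_\phi$ equals $\Lambda(\phi)$ for some $\phi$ which is an allowed phase, or satisfies $e^{2iM\phi}\ne1$, or lies in $\pi\mathbb Z$. -/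

import Mathlib

noncomputable section

namespace RelToda

/-! ### Dispersion functions

Throughout, `K` is the capital parameter, i.e. the `N`-th power of the coupling `κ` of the quantum
chain. -/

/-- `√(cos² φ + K) + cos φ`, with the principal square root. -/
def radical (K φ : ℂ) : ℂ := (Complex.cos φ ^ 2 + K) ^ (1 / 2 : ℂ) + Complex.cos φ

/-- `Δ(φ)`. -/
def Delta (K φ : ℂ) : ℂ := Complex.exp (Complex.I * φ) * radical K φ

/-- `Δ*(φ)`. -/
def DeltaStar (K φ : ℂ) : ℂ := Complex.exp (-(Complex.I * φ)) * radical K φ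

/-- `Λ(φ) = Δ(φ) Δ*(φ)`. -/
def Lam (K φ : ℂ) : ℂ := Delta K φ * DeltaStar K φ

/-- The phase shift `d(φ, φ')`. -/
def phaseShift (K φ φ' : ℂ) : ℂ :=
  ((Delta K φ - Delta K φ') * (DeltaStar K φ - DeltaStar K φ')) /
    ((Delta K φ - DeltaStar K φ') * (DeltaStar K φ - Delta K φ'))

/-- The function `c(φ)`. -/
def cFun (K φ : ℂ) : ℂ :=
  DeltaStar K φ / Delta K φ * ((1 - Delta K φ) / (1 - DeltaStar K φ))

/-- The function `s(φ, φ')`. -/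
def sFun (K φ φ' : ℂ) : ℂ :=
  DeltaStar K φ / Delta K φ *
    ((DeltaStar K φ' - Delta K φ) / (DeltaStar K φ' - DeltaStar K φ))

/-- The finite set `{π/M, 2π/M, …, (M-1)π/M}` of allowed phases. -/
def allowedPhases (M : ℕ) : Set ℂ :=
  {φ | ∃ j : ℕ, 0 < j ∧ j < M ∧ φ = (j : ℂ) * (Real.pi : ℂ) / (M : ℂ)}

/-! ### Solitonic tau-functions -/

/-- The `n`-solitonic tau-function at the point `m`, with amplitudes `f` and phases `φ`. -/
def tau (K : ℂ) : (n : ℕ) → (Fin n → ℂ) → (Fin n → ℂ) → ℕ → ℂ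
  | 0, _, _, _ => 1
  | n + 1, f, φ, m =>
      tau K n (fun k => f k.castSucc) (fun k => φ k.castSucc) m +
        f (Fin.last n) * Complex.exp (2 * Complex.I * (m : ℂ) * φ (Fin.last n)) *
          tau K n (fun k => phaseShift K (φ k.castSucc) (φ (Fin.last n)) * f k.castSucc)
            (fun k => φ k.castSucc) m

/-- The second tau-function `Θ`, with amplitudes `c(φ_k) f_k`. -/
def Theta (K : ℂ) (n : ℕ) (f φ : Fin n → ℂ) (m : ℕ) : ℂ :=
  tau K n (fun k => cFun K (φ k) * f k) φ m

/-! ### Solitonic states of the chain -/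

/-- `ω^{-1/2}` for `ω = exp(2πi/N)`, where `ω^{1/2} = exp(πi/N)`. -/
def omegaInvSqrt (N : ℕ) : ℂ := Complex.exp (-((Real.pi : ℂ) * Complex.I / (N : ℂ)))

/-- An `n`-solitonic state of the chain of length `M` with data `{f_k, φ_k}`: the phases are
distinct and allowed, and `τ`, `θ` are (nonzero) `N`-th roots of the two tau-functions, indexed by
`ℤ/M`. -/
structure SolitonState (N M : ℕ) (κ : ℂ) {n : ℕ} (f φ : Fin n → ℂ) where
  phase_mem : ∀ k, φ k ∈ allowedPhases M
  phase_injective : Function.Injective φ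
  τ : ZMod M → ℂ
  θ : ZMod M → ℂ
  τ_ne_zero : ∀ m, τ m ≠ 0
  θ_ne_zero : ∀ m, θ m ≠ 0
  τ_pow : ∀ m : ℕ, τ (m : ZMod M) ^ N = tau (κ ^ N) n f φ m
  θ_pow : ∀ m : ℕ, θ (m : ZMod M) ^ N = Theta (κ ^ N) n f φ m

/-- The parameters `u_m = -ω^{-1/2} τ_{m-1} / τ_m`; the index `i : Fin M` stands for the site
`m = i + 1`. -/
def SolitonState.u {N M : ℕ} {κ : ℂ} {n : ℕ} {f φ : Fin n → ℂ}
    (s : SolitonState N M κ f φ) (i : Fin M) : ℂ :=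
  -omegaInvSqrt N * (s.τ ((i : ℕ) : ZMod M) / s.τ (((i : ℕ) + 1 : ℕ) : ZMod M))

/-- The parameters `w_m = -θ_m / θ_{m-1}`; the index `i : Fin M` stands for the site `m = i + 1`. -/
def SolitonState.w {N M : ℕ} {κ : ℂ} {n : ℕ} {f φ : Fin n → ℂ}
    (s : SolitonState N M κ f φ) (i : Fin M) : ℂ :=
  -(s.θ (((i : ℕ) + 1 : ℕ) : ZMod M) / s.θ ((i : ℕ) : ZMod M))

/-- The chain with parameters `u`, `w` is in the state `s`, up to the choice of the phases of
`u_m`, `w_m` (`N`-th roots of unity) and up to the gauge transformation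
`U_m ↦ C U_m`, `W_m ↦ C⁻¹ W_m` of the `N`-th powers `U_m = u_m^N`, `W_m = w_m^N`. -/
def InStateUpToGauge {N M : ℕ} {κ : ℂ} {n : ℕ} {f φ : Fin n → ℂ}
    (C : ℂ) (u w : Fin M → ℂ) (s : SolitonState N M κ f φ) : Prop :=
  ∀ i, u i ^ N = C * s.u i ^ N ∧ w i ^ N = C⁻¹ * s.w i ^ N

/-- The chain with parameters `u`, `w` is in the state `s`, up to the choice of the phases of
`u_m`, `w_m`. -/
def InState {N M : ℕ} {κ : ℂ} {n : ℕ} {f φ : Fin n → ℂ}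
    (u w : Fin M → ℂ) (s : SolitonState N M κ f φ) : Prop :=
  ∀ i, u i ^ N = s.u i ^ N ∧ w i ^ N = s.w i ^ N

/-! ### Darboux transformation -/

/-- The classical Lax matrix `L` of a site, at the spectral parameter `Λ`. -/
def laxL (K Λ U W : ℂ) : Matrix (Fin 2) (Fin 2) ℂ :=
  !![1 + K / Λ * (U * W), U / Λ; W, 0]

/-- The classical auxiliary ("dimer self trapping") Lax matrix, with parameters `Kφ`, `Λφ`. -/
def laxAux (Kφ Λφ Λ U W : ℂ) : Matrix (Fin 2) (Fin 2) ℂ :=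
  !![1 + Kφ * (Λφ / Λ) * W, U / Λ * (1 + Kφ * W); Λφ * (W / U), W]

/-- The chain `(u', w')` is produced from the chain `(u, w)` by a solution of the cyclic boundary
conditions with spectral parameter `φ`, i.e. with `Λφ = Λ(φ)` and `Kφ = K / Δ(φ)`:
there are nonzero auxiliary parameters `u_{φ,m}`, `w_{φ,m}`, `1 ≤ m ≤ M + 1`, which satisfy the
Darboux relation at all sites, identically in `Λ`, and the cyclic conditions
`u_{φ,M+1} = u_{φ,1}`, `w_{φ,M+1} = w_{φ,1}`. -/
def CyclicDarboux (N M : ℕ) (κ φ : ℂ) (u w u' w' : Fin M → ℂ) : Prop :=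
  ∃ uφ wφ : Fin (M + 1) → ℂ,
    (∀ i, uφ i ≠ 0 ∧ wφ i ≠ 0) ∧
    (∀ i : Fin M, ∀ Λ : ℂ, Λ ≠ 0 →
      laxAux (κ ^ N / Delta (κ ^ N) φ) (Lam (κ ^ N) φ) Λ (uφ i.castSucc ^ N) (wφ i.castSucc ^ N) *
          laxL (κ ^ N) Λ (u i ^ N) (w i ^ N) =
        laxL (κ ^ N) Λ (u' i ^ N) (w' i ^ N) *
          laxAux (κ ^ N / Delta (κ ^ N) φ) (Lam (κ ^ N) φ) Λ (uφ i.succ ^ N) (wφ i.succ ^ N)) ∧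
    uφ (Fin.last M) = uφ 0 ∧ wφ (Fin.last M) = wφ 0

end RelToda

end

noncomputable section

namespace RelToda

/-! ### Hirota bilinear relations -/

/-! The Darboux relation at one site determines `u'` and `w'` explicitly and leaves a Möbius
recursion for the `N`-th powers of the auxiliary parameters. Writing `u_φ^N`, up to sign, as a ratio
of consecutive values of a sequence `P` linearizes it. Cyclic solutions thus become nowhere
vanishing quasi-periodic solutions of the linear problem `LinSol` (`cyclicDarboux_iff`). Eliminating
`R` leaves the second-order recurrence `TauRec` for `P`, so the question is to find the eigenvectors
of a 2×2 monodromy.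

Explicit solutions come from Hirota theory. The points (Δ(φ), Δ*(φ)) lie on the hyperbola (x - 1)(y
- 1) = 1 + K, and T is a tau-function with poles p_k = Δ(φ_k), q_k = Δ*(φ_k). Relative to a base
amplitude, T carries the vertex factor at 0, Θ the one at 1, and m ↦ m + 1 inserts another factor at
0. If (z, w) is on the curve and zw = Λ_φ, inserting the factor at z and multiplying by w^(-m) gives
a solution (`linSol_shift`). This is the three-term Hirota–Miwa relation, combined with the fact
that the factors at conjugate points of the curve multiply to the factor at 1 (`vertex_mul_conj`).
The two orders of (z, w) are the branches ±φ; their Casoratian is (z - w) T Θ up to normalization,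
and their multipliers are Δ(φ)^(-M) and Δ*(φ)^(-M).

For an allowed phase that is not in the state, the two multipliers agree and the branches are
independent. Every combination is then quasi-periodic, and it is the tau-function with one more
soliton (`creation_eq`). If e^(2iMφ) ≠ 1, the multipliers differ and only the two branches survive.
For φ ∈ πℤ the branches coincide; for φ = ±φ_j with f_j ≠ 0 one of them has a pole whose residue is
a multiple of the other. In both situations, differentiating along the curve produces a second
solution on which the monodromy is a nontrivial Jordan block (`TauRec.of_collision`), so one
quasi-periodic solution remains up to a factor. The Jordan block is nontrivial because Λ + K ≠ 0,
which follows from cos² φ + K ≠ 0. -/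

/-- The vertex factor `(z - p) / (z - q)`. -/
def vertex (p q z : ℂ) : ℂ := (z - p) / (z - q)

/-- The tau-function `∑_S ∏_{k ∈ S} f_k ∏_{k < l ∈ S} d_{kl}` for the poles `p`, `q`. -/
def hirotaTau : (n : ℕ) → (p q f : Fin n → ℂ) → ℂ
  | 0, _, _, _ => 1
  | n + 1, p, q, f =>
      hirotaTau n (fun k => p k.castSucc) (fun k => q k.castSucc) (fun k => f k.castSucc) +
        f (Fin.last n) *
          hirotaTau n (fun k => p k.castSucc) (fun k => q k.castSucc)
            (fun k => f k.castSucc * (vertex (p k.castSucc) (q k.castSucc) (p (Fin.last n)) /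
              vertex (p k.castSucc) (q k.castSucc) (q (Fin.last n))))

/-- The poles are pairwise distinct. -/
structure DistinctPoles {n : ℕ} (p q : Fin n → ℂ) : Prop where
  left : Function.Injective p
  right : Function.Injective q
  ne : ∀ k l, p k ≠ q l

theorem DistinctPoles.init {n : ℕ} {p q : Fin (n + 1) → ℂ} (h : DistinctPoles p q) :
    DistinctPoles (fun k : Fin n => p k.castSucc) (fun k : Fin n => q k.castSucc) :=
  ⟨h.left.comp (Fin.castSucc_injective _), h.right.comp (Fin.castSucc_injective _),
    fun _ _ => h.ne _ _⟩

/-- The points of `A` avoid the poles. -/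
def Avoids {n : ℕ} (p q : Fin n → ℂ) (A : Finset ℂ) : Prop :=
  ∀ a ∈ A, ∀ k, a ≠ p k ∧ a ≠ q k

theorem Avoids.init {n : ℕ} {p q : Fin (n + 1) → ℂ} {A : Finset ℂ} (h : Avoids p q A) :
    Avoids (fun k : Fin n => p k.castSucc) (fun k : Fin n => q k.castSucc) A :=
  fun a ha _ => h a ha _

theorem Avoids.insert {n : ℕ} {p q : Fin n → ℂ} {A : Finset ℂ} (h : Avoids p q A) {z : ℂ}
    (hz : ∀ k, z ≠ p k ∧ z ≠ q k) : Avoids p q (insert z A) := by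
  intro a ha k
  rcases Finset.mem_insert.1 ha with rfl | ha
  · exact hz k
  · exact h a ha k

/-- By Lagrange interpolation on `A` the sum is the coefficient of X^(|A| - 1) in ∏ (X - b), whose
degree |B| is too small. This is the bilinear relation without solitons. -/
theorem sum_prod_sub_div_eq_zero (A B : Finset ℂ) (h : B.card + 2 ≤ A.card) :
    ∑ x ∈ A, (∏ b ∈ B, (x - b)) / ∏ y ∈ A.erase x, (x - y) = 0 := by
  have hdeg : (∏ b ∈ B, (Polynomial.X - Polynomial.C b)).natDegree = B.card := by
    simp
  have hm : (∏ b ∈ B, (Polynomial.X - Polynomial.C b)).Monic :=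
    Polynomial.monic_prod_of_monic _ _ fun b _ => Polynomial.monic_X_sub_C b
  have hlt : (∏ b ∈ B, (Polynomial.X - Polynomial.C b)).degree < (A.card : WithBot ℕ) := by
    rw [Polynomial.degree_eq_natDegree hm.ne_zero, hdeg]
    exact_mod_cast (by omega : B.card < A.card)
  have := Lagrange.coeff_eq_sum (s := A) (v := fun x : ℂ => x) (Set.injOn_id _) hlt
  rw [Polynomial.coeff_eq_zero_of_natDegree_lt (by omega)] at this
  rw [this]
  refine Finset.sum_congr rfl fun x _ => ?_
  simp [Polynomial.eval_prod]

theorem vertex_ne_zero {p q z : ℂ} (hp : z ≠ p) (hq : z ≠ q) : vertex p q z ≠ 0 :=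
  div_ne_zero (sub_ne_zero.2 hp) (sub_ne_zero.2 hq)

/-- The weight of the point `x` in the bilinear relation for `A`, `B`. -/
def bilinearWeight (A B : Finset ℂ) (x : ℂ) : ℂ :=
  (∏ b ∈ B, (x - b)) / ∏ y ∈ A.erase x, (x - y)

/-- A vertex factor of the last soliton can be absorbed into the weight by enlarging both sets. This
turns the cross terms of the induction into relations of the same kind. -/
theorem bilinearWeight_insert {A B : Finset ℂ} {p q x : ℂ} (hx : x ∈ A) (hqA : q ∉ A)
    (hpB : p ∉ B) :
    bilinearWeight (insert q A) (insert p B) x = vertex p q x * bilinearWeight A B x := by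
  have hne : x ≠ q := fun h => hqA (h ▸ hx)
  rw [bilinearWeight, bilinearWeight, Finset.prod_insert hpB,
    Finset.erase_insert_of_ne hne.symm, Finset.prod_insert (by simp [hqA]), vertex,
    mul_div_mul_comm]

theorem bilinearWeight_insert_self {A B : Finset ℂ} {p q : ℂ} (hqA : q ∉ A) (hpB : p ∉ B) :
    bilinearWeight (insert q A) (insert p B) q =
      (q - p) * ((∏ b ∈ B, (q - b)) / ∏ y ∈ A, (q - y)) := by
  rw [bilinearWeight, Finset.prod_insert hpB, Finset.erase_insert hqA, mul_div_assoc]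

/-- The Hirota bilinear relations. -/
theorem hirota_bilinear (n : ℕ) : ∀ (p q f : Fin n → ℂ) (A B : Finset ℂ), DistinctPoles p q →
    Avoids p q A → Avoids p q B → B.card + 2 ≤ A.card →
    ∑ x ∈ A, bilinearWeight A B x *
      (hirotaTau n p q (fun k => f k * ∏ y ∈ A.erase x, vertex (p k) (q k) y) *
        hirotaTau n p q
          (fun k => f k * ((∏ b ∈ B, vertex (p k) (q k) b) * vertex (p k) (q k) x))) = 0 := by
  induction n with
  | zero =>
    intro p q f A B _ _ _ hc
    simpa [hirotaTau, bilinearWeight] using sum_prod_sub_div_eq_zero A B hc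
  | succ n ih =>
    intro p q f A B hpq hA hB hc
    set pl := p (Fin.last n) with hpl
    set ql := q (Fin.last n) with hql
    set p' : Fin n → ℂ := fun k => p k.castSucc with hp'
    set q' : Fin n → ℂ := fun k => q k.castSucc with hq'
    set f' : Fin n → ℂ := fun k => f k.castSucc with hf'
    have hpq' : DistinctPoles p' q' := hpq.init
    have hA' : Avoids p' q' A := hA.init
    have hB' : Avoids p' q' B := hB.init
    have hpA : pl ∉ A := fun h => (hA _ h (Fin.last n)).1 rfl
    have hqA : ql ∉ A := fun h => (hA _ h (Fin.last n)).2 rfl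
    have hpB : pl ∉ B := fun h => (hB _ h (Fin.last n)).1 rfl
    have hqB : ql ∉ B := fun h => (hB _ h (Fin.last n)).2 rfl
    have hpk : ∀ k, pl ≠ p' k ∧ pl ≠ q' k := fun k =>
      ⟨fun h => (Fin.castSucc_lt_last k).ne' (hpq.left h), hpq.ne _ _⟩
    have hqk : ∀ k, ql ≠ p' k ∧ ql ≠ q' k := fun k =>
      ⟨fun h => hpq.ne _ _ h.symm, fun h => (Fin.castSucc_lt_last k).ne' (hpq.right h)⟩
    set d : Fin n → ℂ := fun k => vertex (p' k) (q' k) pl / vertex (p' k) (q' k) ql with hd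
    -- With this normalization the extra point `ql` in `A` restores `f'` in the first factor, while
    -- the extra point `pl` in `B` produces `f' * d` in the second. Exchanging `pl` and `ql`
    -- exchanges the two effects.
    set g : Fin n → ℂ := fun k => f' k / vertex (p' k) (q' k) ql with hg
    have hvq : ∀ k, vertex (p' k) (q' k) ql ≠ 0 := fun k =>
      vertex_ne_zero (hqk k).1 (hqk k).2
    -- the factors of the relation, with and without the interaction `d` with the last soliton
    set H1 : ℂ → ℂ := fun x =>
      hirotaTau n p' q' (fun k => f' k * ∏ y ∈ A.erase x, vertex (p' k) (q' k) y) with hH1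
    set H2 : ℂ → ℂ := fun x => hirotaTau n p' q'
      (fun k => f' k * ((∏ b ∈ B, vertex (p' k) (q' k) b) * vertex (p' k) (q' k) x)) with hH2
    set H1d : ℂ → ℂ := fun x => hirotaTau n p' q'
      (fun k => f' k * d k * ∏ y ∈ A.erase x, vertex (p' k) (q' k) y) with hH1d
    set H2d : ℂ → ℂ := fun x => hirotaTau n p' q'
      (fun k => f' k * d k * ((∏ b ∈ B, vertex (p' k) (q' k) b) * vertex (p' k) (q' k) x))
      with hH2d
    set E : ℂ := hirotaTau n p' q' (fun k => g k * ∏ y ∈ A, vertex (p' k) (q' k) y) *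
      hirotaTau n p' q' (fun k => g k * (vertex (p' k) (q' k) pl *
        (∏ b ∈ B, vertex (p' k) (q' k) b) * vertex (p' k) (q' k) ql)) with hE
    -- Expanding both tau-functions in the last soliton gives four terms. It occurs in neither
    -- factor (`e1`), in both (`e4`), or in exactly one (`e2`, `e3`). The last two use enlarged
    -- sets, and their extra summands contain the same product `E`.
    have e1 := ih p' q' f' A B hpq' hA' hB' hc
    have e4 := ih p' q' (fun k => f' k * d k) A B hpq' hA' hB' hc
    have e2 := ih p' q' g (insert ql A) (insert pl B) hpq' (hA'.insert hqk) (hB'.insert hpk)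
      (by rw [Finset.card_insert_of_notMem hqA, Finset.card_insert_of_notMem hpB]; omega)
    have e3 := ih p' q' g (insert pl A) (insert ql B) hpq' (hA'.insert hpk) (hB'.insert hqk)
      (by rw [Finset.card_insert_of_notMem hpA, Finset.card_insert_of_notMem hqB]; omega)
    rw [Finset.sum_insert hqA, bilinearWeight_insert_self hqA hpB] at e2
    rw [Finset.sum_insert hpA, bilinearWeight_insert_self hpA hqB] at e3
    have e2' : ∑ x ∈ A, vertex pl ql x * bilinearWeight A B x * (H1 x * H2d x) +
        (ql - pl) * ((∏ b ∈ B, (ql - b)) / ∏ y ∈ A, (ql - y)) * E = 0 := by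
      rw [← e2, add_comm]
      congr 1
      · simp only [hE, Finset.erase_insert hqA, Finset.prod_insert hpB]
      · refine Finset.sum_congr rfl fun x hx => ?_
        have hne : x ≠ ql := fun h => hqA (h ▸ hx)
        rw [bilinearWeight_insert hx hqA hpB, hH1, hH2d]
        congr 2
        · refine congrArg (hirotaTau n p' q') (funext fun k => ?_)
          rw [Finset.erase_insert_of_ne hne.symm, Finset.prod_insert (by simp [hqA]), hg]
          field_simp [hvq k]
        · refine congrArg (hirotaTau n p' q') (funext fun k => ?_)
          rw [Finset.prod_insert hpB, hg, hd]
          ring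
    have e3' : ∑ x ∈ A, vertex ql pl x * bilinearWeight A B x * (H1d x * H2 x) +
        (pl - ql) * ((∏ b ∈ B, (pl - b)) / ∏ y ∈ A, (pl - y)) * E = 0 := by
      rw [← e3, add_comm]
      congr 1
      · simp only [hE, Finset.erase_insert hpA, Finset.prod_insert hqB]
        refine congrArg (_ * ·) (congrArg (_ * ·) (congrArg _ (funext fun k => ?_)))
        ring
      · refine Finset.sum_congr rfl fun x hx => ?_
        have hne : x ≠ pl := fun h => hpA (h ▸ hx)
        rw [bilinearWeight_insert hx hpA hqB, hH1d, hH2]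
        congr 2
        · refine congrArg (hirotaTau n p' q') (funext fun k => ?_)
          rw [Finset.erase_insert_of_ne hne.symm, Finset.prod_insert (by simp [hpA]), hg, hd]
          ring
        · refine congrArg (hirotaTau n p' q') (funext fun k => ?_)
          rw [Finset.prod_insert hqB, hg]
          field_simp [hvq k]
    have key : ∀ x ∈ A, bilinearWeight A B x *
        (hirotaTau (n + 1) p q (fun k => f k * ∏ y ∈ A.erase x, vertex (p k) (q k) y) *
        hirotaTau (n + 1) p q
          (fun k => f k * ((∏ b ∈ B, vertex (p k) (q k) b) * vertex (p k) (q k) x))) =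
        bilinearWeight A B x * (H1 x * H2 x) +
        f (Fin.last n) * (∏ b ∈ B, vertex pl ql b) *
          (vertex pl ql x * bilinearWeight A B x * (H1 x * H2d x)) +
        f (Fin.last n) * (∏ y ∈ A, vertex pl ql y) *
          (vertex ql pl x * bilinearWeight A B x * (H1d x * H2 x)) +
        f (Fin.last n) ^ 2 * ((∏ b ∈ B, vertex pl ql b) * ∏ y ∈ A, vertex pl ql y) *
          (bilinearWeight A B x * (H1d x * H2d x)) := by
      intro x hx
      have hx1 : x - pl ≠ 0 := sub_ne_zero.2 fun h => hpA (h ▸ hx)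
      have hx2 : x - ql ≠ 0 := sub_ne_zero.2 fun h => hqA (h ▸ hx)
      have hv : vertex ql pl x * vertex pl ql x = 1 := by
        rw [vertex, vertex]; field_simp
      have r1 : hirotaTau (n + 1) p q (fun k => f k * ∏ y ∈ A.erase x, vertex (p k) (q k) y) =
          H1 x + f (Fin.last n) * (∏ y ∈ A.erase x, vertex pl ql y) * H1d x := by
        rw [hirotaTau, hH1, hH1d]
        congr 3
        funext k
        ring
      have r2 : hirotaTau (n + 1) p q
          (fun k => f k * ((∏ b ∈ B, vertex (p k) (q k) b) * vertex (p k) (q k) x)) =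
          H2 x + f (Fin.last n) * ((∏ b ∈ B, vertex pl ql b) * vertex pl ql x) * H2d x := by
        rw [hirotaTau, hH2, hH2d]
        congr 3
        funext k
        ring
      rw [r1, r2, ← Finset.mul_prod_erase A _ hx]
      linear_combination (-(f (Fin.last n) * (∏ y ∈ A.erase x, vertex pl ql y) *
        (bilinearWeight A B x * (H1d x * H2 x)))) * hv
    rw [Finset.sum_congr rfl key, Finset.sum_add_distrib, Finset.sum_add_distrib,
      Finset.sum_add_distrib, ← Finset.mul_sum, ← Finset.mul_sum, ← Finset.mul_sum]
    have e1' : ∑ x ∈ A, bilinearWeight A B x * (H1 x * H2 x) = 0 := e1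
    have e4' : ∑ x ∈ A, bilinearWeight A B x * (H1d x * H2d x) = 0 := e4
    -- The extra summands of the two enlarged relations cancel, because the vertex factors convert
    -- products of differences with `ql` into products of differences with `pl`.
    have hcancel : (∏ b ∈ B, vertex pl ql b) *
          ((ql - pl) * ((∏ b ∈ B, (ql - b)) / ∏ y ∈ A, (ql - y))) +
        (∏ y ∈ A, vertex pl ql y) *
          ((pl - ql) * ((∏ b ∈ B, (pl - b)) / ∏ y ∈ A, (pl - y))) = 0 := by
      have hb : (∏ b ∈ B, vertex pl ql b) * ∏ b ∈ B, (ql - b) = ∏ b ∈ B, (pl - b) := by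
        rw [← Finset.prod_mul_distrib]
        refine Finset.prod_congr rfl fun b hb => ?_
        have : b - ql ≠ 0 := sub_ne_zero.2 fun h => hqB (h ▸ hb)
        rw [vertex]
        field_simp
        ring
      have ha : (∏ y ∈ A, vertex pl ql y) * ∏ y ∈ A, (ql - y) = ∏ y ∈ A, (pl - y) := by
        rw [← Finset.prod_mul_distrib]
        refine Finset.prod_congr rfl fun b hb => ?_
        have : b - ql ≠ 0 := sub_ne_zero.2 fun h => hqA (h ▸ hb)
        rw [vertex]
        field_simp
        ring
      have n1 : ∏ y ∈ A, (ql - y) ≠ 0 :=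
        Finset.prod_ne_zero_iff.2 fun y hy => sub_ne_zero.2 fun h => hqA (h ▸ hy)
      have n2 : ∏ y ∈ A, (pl - y) ≠ 0 :=
        Finset.prod_ne_zero_iff.2 fun y hy => sub_ne_zero.2 fun h => hpA (h ▸ hy)
      field_simp
      linear_combination (ql - pl) * (∏ y ∈ A, (pl - y)) * hb -
        (ql - pl) * (∏ b ∈ B, (pl - b)) * ha
    rw [e1', e4']
    linear_combination f (Fin.last n) * (∏ b ∈ B, vertex pl ql b) * e2' +
      f (Fin.last n) * (∏ y ∈ A, vertex pl ql y) * e3' - f (Fin.last n) * E * hcancel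

/-- The tau-function is polynomial in its amplitudes. This is used to pass to the limit at a pole
and to differentiate families of solutions. -/
theorem hirotaTau_differentiableAt {n : ℕ} : ∀ (p q : Fin n → ℂ) (f : ℂ → Fin n → ℂ) (z₀ : ℂ),
    (∀ k, DifferentiableAt ℂ (fun z => f z k) z₀) →
    DifferentiableAt ℂ (fun z => hirotaTau n p q (f z)) z₀ := by
  induction n with
  | zero => intro p q f z₀ _; simp [hirotaTau]
  | succ n ih =>
    intro p q f z₀ h
    simp only [hirotaTau]
    exact (ih _ _ (fun z k => f z k.castSucc) z₀ fun k => h _).add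
      ((h _).mul (ih _ _ (fun z k => f z k.castSucc * _) z₀ fun k => (h _).mul_const _))

theorem vertex_differentiableAt {p q z : ℂ} (h : z ≠ q) : DifferentiableAt ℂ (vertex p q) z := by
  unfold vertex
  exact (differentiableAt_id.sub_const p).div (differentiableAt_id.sub_const q) (sub_ne_zero.2 h)

/-- The three-term Hirota–Miwa relation. -/
theorem hirota_three_term {n : ℕ} {p q : Fin n → ℂ} (f : Fin n → ℂ) (hpq : DistinctPoles p q)
    {a b c : ℂ} (ha : ∀ k, a ≠ p k ∧ a ≠ q k) (hb : ∀ k, b ≠ p k ∧ b ≠ q k)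
    (hc : ∀ k, c ≠ p k ∧ c ≠ q k) :
    (b - c) * (hirotaTau n p q (fun k => f k * vertex (p k) (q k) a) *
        hirotaTau n p q (fun k => f k * (vertex (p k) (q k) b * vertex (p k) (q k) c))) +
      (c - a) * (hirotaTau n p q (fun k => f k * vertex (p k) (q k) b) *
        hirotaTau n p q (fun k => f k * (vertex (p k) (q k) a * vertex (p k) (q k) c))) +
      (a - b) * (hirotaTau n p q (fun k => f k * vertex (p k) (q k) c) *
        hirotaTau n p q (fun k => f k * (vertex (p k) (q k) a * vertex (p k) (q k) b))) = 0 := by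
  by_cases hab : a = b
  · subst hab; ring
  by_cases hac : a = c
  · subst hac
    simp only [mul_comm (vertex _ _ b)]
    ring
  by_cases hbc : b = c
  · subst hbc; ring
  have hA : Avoids p q {a, b, c} := by
    intro x hx
    simp only [Finset.mem_insert, Finset.mem_singleton] at hx
    rcases hx with rfl | rfl | rfl <;> assumption
  have hB : Avoids p q ∅ := by simp [Avoids]
  -- Three points against none. Multiplying by (a - b)(a - c)(b - c) turns the weights into the
  -- differences of the statement. Coinciding points had to be excluded because `A` is a set.
  have h := hirota_bilinear n p q f {a, b, c} ∅ hpq hA hB (by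
    rw [Finset.card_insert_of_notMem (by simp [hab, hac]), Finset.card_pair hbc]; simp)
  have ea : ({a, b, c} : Finset ℂ).erase a = {b, c} :=
    Finset.erase_insert (by simp [hab, hac])
  have eb : ({a, b, c} : Finset ℂ).erase b = {a, c} := by
    rw [Finset.insert_comm]
    exact Finset.erase_insert (by simp [Ne.symm hab, hbc])
  have ec : ({a, b, c} : Finset ℂ).erase c = {a, b} := by
    rw [Finset.pair_comm b c, Finset.insert_comm]
    exact Finset.erase_insert (by simp [Ne.symm hac, Ne.symm hbc])
  rw [Finset.sum_insert (by simp [hab, hac]), Finset.sum_pair hbc] at h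
  simp only [bilinearWeight, ea, eb, ec, Finset.prod_pair hbc, Finset.prod_pair hac,
    Finset.prod_pair hab, Finset.prod_empty, one_mul] at h
  have h1 : a - b ≠ 0 := sub_ne_zero.2 hab
  have h2 : a - c ≠ 0 := sub_ne_zero.2 hac
  have h3 : b - c ≠ 0 := sub_ne_zero.2 hbc
  have h4 : b - a ≠ 0 := sub_ne_zero.2 (Ne.symm hab)
  have h5 : c - a ≠ 0 := sub_ne_zero.2 (Ne.symm hac)
  have h6 : c - b ≠ 0 := sub_ne_zero.2 (Ne.symm hbc)
  have i1 : (b - c) = (a - b) * (a - c) * (b - c) * (1 / ((a - b) * (a - c))) := by field_simp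
  have i2 : (c - a) = (a - b) * (a - c) * (b - c) * (1 / ((b - a) * (b - c))) := by
    field_simp; ring
  have i3 : (a - b) = (a - b) * (a - c) * (b - c) * (1 / ((c - a) * (c - b))) := by
    field_simp; ring
  generalize hirotaTau n p q (fun k => f k * vertex (p k) (q k) a) = A at h ⊢
  generalize hirotaTau n p q (fun k => f k * vertex (p k) (q k) b) = B at h ⊢
  generalize hirotaTau n p q (fun k => f k * vertex (p k) (q k) c) = C at h ⊢
  generalize hirotaTau n p q
    (fun k => f k * (vertex (p k) (q k) b * vertex (p k) (q k) c)) = A' at h ⊢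
  generalize hirotaTau n p q
    (fun k => f k * (vertex (p k) (q k) a * vertex (p k) (q k) c)) = B' at h ⊢
  generalize hirotaTau n p q
    (fun k => f k * (vertex (p k) (q k) a * vertex (p k) (q k) b)) = C' at h ⊢
  linear_combination (a - b) * (a - c) * (b - c) * h + A * A' * i1 + B * B' * i2 + C * C' * i3

theorem eventually_avoids {n : ℕ} (p : Fin n → ℂ) (z₀ : ℂ) :
    ∀ᶠ z in nhdsWithin z₀ {z₀}ᶜ, ∀ k, z ≠ p k := by
  rw [Filter.eventually_all]
  intro k
  by_cases h : p k = z₀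
  · rw [h]; exact eventually_mem_nhdsWithin
  · exact nhdsWithin_le_nhds (isOpen_ne.mem_nhds (Ne.symm h))

/-- A function which is continuous at a point and vanishes nearby vanishes at the point. -/
theorem eq_zero_of_eventually_zero {g : ℂ → ℂ} {z₀ : ℂ} (hg : ContinuousAt g z₀)
    (h : ∀ᶠ z in nhdsWithin z₀ {z₀}ᶜ, g z = 0) : g z₀ = 0 :=
  tendsto_nhds_unique (hg.tendsto.mono_left nhdsWithin_le_nhds)
    (tendsto_const_nhds.congr' (h.mono fun _ hz => hz.symm))

/-- In the three-term relation, the point `a` may be one of the poles `p`. -/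
theorem hirota_three_term' {n : ℕ} {p q : Fin n → ℂ} (f : Fin n → ℂ) (hpq : DistinctPoles p q)
    {a b c : ℂ} (ha : ∀ k, a ≠ q k) (hb : ∀ k, b ≠ p k ∧ b ≠ q k)
    (hc : ∀ k, c ≠ p k ∧ c ≠ q k) :
    (b - c) * (hirotaTau n p q (fun k => f k * vertex (p k) (q k) a) *
        hirotaTau n p q (fun k => f k * (vertex (p k) (q k) b * vertex (p k) (q k) c))) +
      (c - a) * (hirotaTau n p q (fun k => f k * vertex (p k) (q k) b) *
        hirotaTau n p q (fun k => f k * (vertex (p k) (q k) a * vertex (p k) (q k) c))) +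
      (a - b) * (hirotaTau n p q (fun k => f k * vertex (p k) (q k) c) *
        hirotaTau n p q (fun k => f k * (vertex (p k) (q k) a * vertex (p k) (q k) b))) = 0 := by
  have hv : ∀ k, DifferentiableAt ℂ (fun z => vertex (p k) (q k) z) a :=
    fun k => vertex_differentiableAt (ha k)
  have d1 := hirotaTau_differentiableAt p q (fun z k => f k * vertex (p k) (q k) z) a
    fun k => (hv k).const_mul _
  have d2 := hirotaTau_differentiableAt p q
    (fun z k => f k * (vertex (p k) (q k) z * vertex (p k) (q k) c)) a
    fun k => ((hv k).mul_const _).const_mul _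
  have d3 := hirotaTau_differentiableAt p q
    (fun z k => f k * (vertex (p k) (q k) z * vertex (p k) (q k) b)) a
    fun k => ((hv k).mul_const _).const_mul _
  -- The left-hand side is continuous in `a` away from the `q k`, so its value at some `p k` is a
  -- limit of values where the relation is known.
  refine eq_zero_of_eventually_zero (g := fun a =>
    (b - c) * (hirotaTau n p q (fun k => f k * vertex (p k) (q k) a) *
        hirotaTau n p q (fun k => f k * (vertex (p k) (q k) b * vertex (p k) (q k) c))) +
      (c - a) * (hirotaTau n p q (fun k => f k * vertex (p k) (q k) b) *
        hirotaTau n p q (fun k => f k * (vertex (p k) (q k) a * vertex (p k) (q k) c))) +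
      (a - b) * (hirotaTau n p q (fun k => f k * vertex (p k) (q k) c) *
        hirotaTau n p q (fun k => f k * (vertex (p k) (q k) a * vertex (p k) (q k) b))))
    (DifferentiableAt.continuousAt (𝕜 := ℂ) ?_) ?_
  · exact (((d1.mul_const _).const_mul _).add
      ((differentiableAt_id.const_sub c).mul (d2.const_mul _))).add
      ((differentiableAt_id.sub_const b).mul (d3.const_mul _))
  · filter_upwards [eventually_avoids p a, eventually_avoids q a] with z h1 h2
    exact hirota_three_term f hpq (fun k => ⟨h1 k, h2 k⟩) hb hc

/-- The interaction factor is symmetric in the two solitons, which makes the tau-function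
independent of their order. -/
theorem vertex_div_symm (p q p' q' : ℂ) :
    vertex p q p' / vertex p q q' = vertex p' q' p / vertex p' q' q := by
  simp only [vertex]
  rw [div_div_div_eq, div_div_div_eq, ← neg_sub p p', ← neg_sub q q', ← neg_sub q p',
    ← neg_sub p q']
  ring

/-- The tau-function may be expanded with respect to any of its solitons. -/
theorem hirotaTau_succAbove {n : ℕ} : ∀ (p q f : Fin (n + 1) → ℂ) (j : Fin (n + 1)),
    hirotaTau (n + 1) p q f =
      hirotaTau n (fun k => p (j.succAbove k)) (fun k => q (j.succAbove k))
          (fun k => f (j.succAbove k)) +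
        f j * hirotaTau n (fun k => p (j.succAbove k)) (fun k => q (j.succAbove k))
          (fun k => f (j.succAbove k) *
            (vertex (p (j.succAbove k)) (q (j.succAbove k)) (p j) /
              vertex (p (j.succAbove k)) (q (j.succAbove k)) (q j))) := by
  induction n with
  | zero =>
    intro p q f j
    rw [show j = Fin.last 0 from Subsingleton.elim (α := Fin 1) j _]
    simp only [Fin.succAbove_last]
    rfl
  | succ n ih =>
    intro p q f j
    induction j using Fin.lastCases with
    | last =>
      simp only [Fin.succAbove_last]
      rfl
    | cast i =>
      have hl : i.castSucc.succAbove (Fin.last n) = Fin.last (n + 1) := 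
        Fin.succAbove_ne_last_last (Fin.castSucc_lt_last i).ne
      -- Split off the last soliton, then soliton `i` in both halves. The two expansions differ only
      -- in the order of the pair in its interaction factor.
      rw [hirotaTau, ih _ _ _ i, ih _ _ _ i]
      simp only [hirotaTau, Fin.castSucc_succAbove_castSucc, hl]
      rw [vertex_div_symm (p (Fin.last (n + 1)))]
      simp only [mul_right_comm (f _) (_ / _) (_ / _)]
      ring

/-! ### The dispersion functions -/

theorem sq_cpow_half (x : ℂ) : (x ^ (1 / 2 : ℂ)) ^ 2 = x := by
  simp

/-- The radical is a root of X² - 2 cos φ X - K. The equation of the curve uses the square root only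
through this. -/
theorem radical_sq (K φ : ℂ) : radical K φ ^ 2 - 2 * Complex.cos φ * radical K φ = K := by
  have := sq_cpow_half (Complex.cos φ ^ 2 + K)
  rw [radical]
  linear_combination this

theorem radical_ne_zero {K : ℂ} (hK : K ≠ 0) (φ : ℂ) : radical K φ ≠ 0 := by
  intro h
  have := radical_sq K φ
  rw [h] at this
  exact hK (by rw [← this]; ring)

theorem Delta_ne_zero {K : ℂ} (hK : K ≠ 0) (φ : ℂ) : Delta K φ ≠ 0 :=
  mul_ne_zero (Complex.exp_ne_zero _) (radical_ne_zero hK φ)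

theorem DeltaStar_ne_zero {K : ℂ} (hK : K ≠ 0) (φ : ℂ) : DeltaStar K φ ≠ 0 :=
  mul_ne_zero (Complex.exp_ne_zero _) (radical_ne_zero hK φ)

theorem Lam_eq (K φ : ℂ) : Lam K φ = radical K φ ^ 2 := by
  have h : Complex.exp (Complex.I * φ) * Complex.exp (-(Complex.I * φ)) = 1 := by
    rw [← Complex.exp_add]; simp
  rw [Lam, Delta, DeltaStar]
  linear_combination radical K φ ^ 2 * h

theorem Lam_ne_zero {K : ℂ} (hK : K ≠ 0) (φ : ℂ) : Lam K φ ≠ 0 :=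
  mul_ne_zero (Delta_ne_zero hK φ) (DeltaStar_ne_zero hK φ)

theorem Delta_add_DeltaStar (K φ : ℂ) :
    Delta K φ + DeltaStar K φ = 2 * Complex.cos φ * radical K φ := by
  rw [Delta, DeltaStar, Complex.cos, show φ * Complex.I = Complex.I * φ by ring,
    show -φ * Complex.I = -(Complex.I * φ) by ring]
  ring

/-- The curve on which `Δ`, `Δ*` lie. -/
theorem Delta_curve (K φ : ℂ) : (Delta K φ - 1) * (DeltaStar K φ - 1) = 1 + K := by
  have h1 : Delta K φ * DeltaStar K φ = radical K φ ^ 2 := Lam_eq K φ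
  have h2 := Delta_add_DeltaStar K φ
  have h3 := radical_sq K φ
  linear_combination h1 - h2 + h3

theorem Delta_neg (K φ : ℂ) : Delta K (-φ) = DeltaStar K φ := by
  simp [Delta, DeltaStar, radical]

theorem DeltaStar_neg (K φ : ℂ) : DeltaStar K (-φ) = Delta K φ := by
  simp [Delta, DeltaStar, radical]

theorem Lam_neg (K φ : ℂ) : Lam K (-φ) = Lam K φ := by
  rw [Lam, Lam, Delta_neg, DeltaStar_neg, mul_comm]

theorem Delta_ne_one {K : ℂ} (hK1 : 1 + K ≠ 0) (φ : ℂ) : Delta K φ ≠ 1 := by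
  intro h
  have := Delta_curve K φ
  rw [h] at this
  exact hK1 (by rw [← this]; ring)

theorem DeltaStar_ne_one {K : ℂ} (hK1 : 1 + K ≠ 0) (φ : ℂ) : DeltaStar K φ ≠ 1 := by
  rw [← Delta_neg]; exact Delta_ne_one hK1 _

theorem Delta_eq_exp_mul (K φ : ℂ) :
    Delta K φ = Complex.exp (2 * Complex.I * φ) * DeltaStar K φ := by
  rw [Delta, DeltaStar, ← mul_assoc, ← Complex.exp_add]
  congr 2
  ring

theorem Delta_div_DeltaStar {K : ℂ} (hK : K ≠ 0) (φ : ℂ) :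
    Delta K φ / DeltaStar K φ = Complex.exp (2 * Complex.I * φ) := by
  rw [Delta_eq_exp_mul, mul_div_cancel_right₀ _ (DeltaStar_ne_zero hK φ)]

/-- A point of the curve is determined by either of its coordinates. -/
theorem curve_unique {K x y x' y' : ℂ} (hK1 : 1 + K ≠ 0) (h : (x - 1) * (y - 1) = 1 + K)
    (h' : (x' - 1) * (y' - 1) = 1 + K) (hx : x = x') : y = y' := by
  subst hx
  have hx1 : x - 1 ≠ 0 := by
    intro h0
    rw [h0, zero_mul] at h
    exact hK1 h.symm
  have := mul_left_cancel₀ hx1 (h.trans h'.symm)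
  linear_combination this

theorem exp_eq_of_Delta_eq {K φ ψ : ℂ} (hK : K ≠ 0) (hK1 : 1 + K ≠ 0)
    (h : Delta K φ = Delta K ψ) :
    Complex.exp (2 * Complex.I * φ) = Complex.exp (2 * Complex.I * ψ) := by
  rw [← Delta_div_DeltaStar hK, ← Delta_div_DeltaStar hK,
    curve_unique hK1 (Delta_curve K φ) (Delta_curve K ψ) h, h]

/-- By the quadratic equation, Λ + K is twice the radical times √(cos² φ + K). Its nonvanishing
separates the velocities of the multipliers in `multiplier_deriv_ne`. -/
theorem Lam_add_ne_zero {K φ : ℂ} (hK : K ≠ 0) (h : Complex.cos φ ^ 2 + K ≠ 0) :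
    Lam K φ + K ≠ 0 := by
  rw [Lam_eq]
  intro h0
  have h1 := radical_sq K φ
  have h2 : radical K φ * (radical K φ - Complex.cos φ) = 0 := by
    linear_combination (h0 + h1) / 2
  have h3 : (Complex.cos φ ^ 2 + K) ^ (1 / 2 : ℂ) = 0 := by
    have := (mul_eq_zero.1 h2).resolve_left (radical_ne_zero hK φ)
    rwa [radical, add_sub_cancel_right] at this
  apply h
  rw [← sq_cpow_half (Complex.cos φ ^ 2 + K), h3]
  simp

/-- Λ is the square of the radical, so the radicals agree up to sign. Equal radicals give equal
cosines by the quadratic equation. Opposite ones give opposite cosines, hence the same principal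
square root on both sides, which would have to vanish. -/
theorem cos_eq_of_Lam_eq {K φ ψ : ℂ} (hK : K ≠ 0) (hφ : Complex.cos φ ^ 2 + K ≠ 0)
    (h : Lam K φ = Lam K ψ) : Complex.cos φ = Complex.cos ψ := by
  have h1 := radical_sq K φ
  have h2 := radical_sq K ψ
  have hr := radical_ne_zero hK φ
  rw [Lam_eq, Lam_eq] at h
  rcases sq_eq_sq_iff_eq_or_eq_neg.1 h with h3 | h3
  · rw [← h3] at h2
    apply mul_right_cancel₀ hr
    linear_combination (h2 - h1) / 2
  · exfalso
    have hr' := radical_ne_zero hK ψ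
    have h4 : Complex.cos φ = -Complex.cos ψ := by
      rw [h3] at h1
      apply mul_right_cancel₀ hr'
      linear_combination (h1 - h2) / 2
    have h5 : (Complex.cos φ ^ 2 + K) ^ (1 / 2 : ℂ) = 0 := by
      rw [radical, radical, show Complex.cos ψ ^ 2 = Complex.cos φ ^ 2 by rw [h4]; ring] at h3
      linear_combination (h3 - h4) / 2
    apply hφ
    rw [← sq_cpow_half (Complex.cos φ ^ 2 + K), h5]
    simp

/-! ### Vertex factors on the curve -/

/-- On the curve (z - p)(w - p) = (1 - p)(zw - pq), and likewise (z - q)(w - q) = (1 - q)(zw - pq).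
The common factor drops out of the quotient. -/
theorem vertex_mul_conj {K p q z w : ℂ} (hK1 : 1 + K ≠ 0) (hpq : (p - 1) * (q - 1) = 1 + K)
    (hzw : (z - 1) * (w - 1) = 1 + K) (hz : z ≠ q) (hw : w ≠ q) :
    vertex p q z * vertex p q w = vertex p q 1 := by
  have hq1 : 1 - q ≠ 0 := by
    intro h0
    have : q - 1 = 0 := by linear_combination -h0
    rw [this, mul_zero] at hpq
    exact hK1 hpq.symm
  have h1 := sub_ne_zero.2 hz
  have h2 := sub_ne_zero.2 hw
  rw [vertex, vertex, vertex, div_mul_div_comm, div_eq_div_iff (mul_ne_zero h1 h2) hq1]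
  linear_combination (p - q) * (hzw - hpq)

theorem sFun_eq (K φ φ' : ℂ) :
    sFun K φ φ' = DeltaStar K φ / Delta K φ *
      vertex (Delta K φ) (DeltaStar K φ) (DeltaStar K φ') := rfl

theorem cFun_eq (K φ : ℂ) :
    cFun K φ = DeltaStar K φ / Delta K φ * vertex (Delta K φ) (DeltaStar K φ) 1 := rfl

/-- This identifies the solitonic `tau` with `hirotaTau` for the poles Δ(φ_k), Δ*(φ_k). -/
theorem phaseShift_eq (K φ φ' : ℂ) :
    phaseShift K φ φ' = vertex (Delta K φ) (DeltaStar K φ) (Delta K φ') /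
      vertex (Delta K φ) (DeltaStar K φ) (DeltaStar K φ') := by
  rw [phaseShift, vertex, vertex, div_div_div_eq]
  congr 1 <;> ring

theorem vertex_zero (p q : ℂ) : vertex p q 0 = p / q := by
  rw [vertex, zero_sub, zero_sub, neg_div_neg_eq]

/-! ### Allowed phases -/

theorem exp_allowed {M : ℕ} (hM : 0 < M) {φ : ℂ} (h : φ ∈ allowedPhases M) :
    Complex.exp (2 * Complex.I * φ) ^ M = 1 := by
  obtain ⟨j, _, _, rfl⟩ := h
  rw [← Complex.exp_nat_mul, Complex.exp_eq_one_iff]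
  refine ⟨j, ?_⟩
  have : (M : ℂ) ≠ 0 := by exact_mod_cast hM.ne'
  push_cast
  field_simp

theorem exp_inj_allowed {M : ℕ} {j k : ℕ} (hj : j < M) (hk : k < M)
    (h : Complex.exp (2 * Complex.I * ((j : ℂ) * (Real.pi : ℂ) / (M : ℂ))) =
      Complex.exp (2 * Complex.I * ((k : ℂ) * (Real.pi : ℂ) / (M : ℂ)))) : j = k := by
  obtain ⟨n, hn⟩ := Complex.exp_eq_exp_iff_exists_int.1 h
  have hM : (M : ℂ) ≠ 0 := by exact_mod_cast (by omega : M ≠ 0)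
  have hpi : (Real.pi : ℂ) ≠ 0 := by exact_mod_cast Real.pi_ne_zero
  have h2 : (j : ℂ) = k + n * M := by
    have h3 : 2 * (Real.pi : ℂ) * Complex.I * (j : ℂ) =
        2 * (Real.pi : ℂ) * Complex.I * (k + n * M) := by
      field_simp at hn
      linear_combination hn * 2 * Real.pi * Complex.I
    exact mul_left_cancel₀ (by simp [hpi]) h3
  have h4 : (j : ℤ) = k + n * M := by exact_mod_cast h2
  have hn0 : n = 0 := by
    rcases lt_trichotomy n 0 with hn | hn | hn
    · nlinarith
    · exact hn
    · nlinarith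
  rw [hn0] at h4
  simpa using h4

theorem exp_allowed_ne_one {M : ℕ} {φ : ℂ} (h : φ ∈ allowedPhases M) :
    Complex.exp (2 * Complex.I * φ) ≠ 1 := by
  obtain ⟨j, h0, hj, rfl⟩ := h
  intro h1
  have := exp_inj_allowed (k := 0) hj (by omega) (by rw [h1]; simp)
  omega

theorem exp_allowed_inj {M : ℕ} {φ ψ : ℂ} (hφ : φ ∈ allowedPhases M) (hψ : ψ ∈ allowedPhases M)
    (h : Complex.exp (2 * Complex.I * φ) = Complex.exp (2 * Complex.I * ψ)) : φ = ψ := by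
  obtain ⟨j, _, hj, rfl⟩ := hφ
  obtain ⟨k, _, hk, rfl⟩ := hψ
  rw [exp_inj_allowed hj hk h]

theorem cos_allowed_inj {M : ℕ} {φ ψ : ℂ} (hφ : φ ∈ allowedPhases M) (hψ : ψ ∈ allowedPhases M)
    (h : Complex.cos φ = Complex.cos ψ) : φ = ψ := by
  obtain ⟨j, _, hj, rfl⟩ := hφ
  obtain ⟨k, _, hk, rfl⟩ := hψ
  have hM : (0 : ℝ) < M := by exact_mod_cast (by omega : 0 < M)
  have hmem : ∀ i : ℕ, i < M → (i : ℝ) * Real.pi / M ∈ Set.Icc 0 Real.pi := by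
    intro i hi
    refine ⟨by positivity, ?_⟩
    rw [div_le_iff₀ hM, mul_comm]
    have : (i : ℝ) ≤ M := by exact_mod_cast hi.le
    exact mul_le_mul_of_nonneg_left this Real.pi_pos.le
  have h' : Real.cos ((j : ℝ) * Real.pi / M) = Real.cos ((k : ℝ) * Real.pi / M) := by
    exact_mod_cast h
  have := Real.injOn_cos (hmem j hj) (hmem k hk) h'
  exact_mod_cast this

/-- The genericity assumption on the capital parameter. -/
structure Generic (M : ℕ) (K : ℂ) : Prop where
  pos : 0 < M
  ne_zero : K ≠ 0
  cos_ne : ∀ j : ℕ, j < M → Complex.cos ((j : ℂ) * (Real.pi : ℂ) / (M : ℂ)) ^ 2 + K ≠ 0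

theorem Generic.one_add {M : ℕ} {K : ℂ} (h : Generic M K) : 1 + K ≠ 0 := by
  simpa using h.cos_ne 0 h.pos

theorem Generic.allowed {M : ℕ} {K φ : ℂ} (h : Generic M K) (hφ : φ ∈ allowedPhases M) :
    Complex.cos φ ^ 2 + K ≠ 0 := by
  obtain ⟨j, _, hj, rfl⟩ := hφ
  exact h.cos_ne j hj

theorem Delta_ne_Delta {M : ℕ} {K φ ψ : ℂ} (h : Generic M K) (hφ : φ ∈ allowedPhases M)
    (hψ : ψ ∈ allowedPhases M) (hne : φ ≠ ψ) : Delta K φ ≠ Delta K ψ := fun h0 =>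
  hne (exp_allowed_inj hφ hψ (exp_eq_of_Delta_eq h.ne_zero h.one_add h0))

theorem DeltaStar_ne_DeltaStar {M : ℕ} {K φ ψ : ℂ} (h : Generic M K) (hφ : φ ∈ allowedPhases M)
    (hψ : ψ ∈ allowedPhases M) (hne : φ ≠ ψ) : DeltaStar K φ ≠ DeltaStar K ψ := fun h0 =>
  Delta_ne_Delta h hφ hψ hne (curve_unique h.one_add
    ((mul_comm _ _).trans (Delta_curve K φ)) ((mul_comm _ _).trans (Delta_curve K ψ)) h0)

theorem Delta_ne_DeltaStar_self {M : ℕ} {K φ : ℂ} (h : Generic M K) (hφ : φ ∈ allowedPhases M) :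
    Delta K φ ≠ DeltaStar K φ := fun h0 =>
  exp_allowed_ne_one hφ (by
    rw [← Delta_div_DeltaStar h.ne_zero, h0, div_self (DeltaStar_ne_zero h.ne_zero φ)])

/-- Equality would make the two points of the curve conjugate, so they would have the same Λ and
hence the same cosine. The cosine is injective on the allowed phases, and for φ = ψ the quotient
Δ/Δ* = e^(2iφ) is not 1. -/
theorem Delta_ne_DeltaStar {M : ℕ} {K φ ψ : ℂ} (h : Generic M K) (hφ : φ ∈ allowedPhases M)
    (hψ : ψ ∈ allowedPhases M) : Delta K φ ≠ DeltaStar K ψ := by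
  by_cases hne : φ = ψ
  · subst hne; exact Delta_ne_DeltaStar_self h hφ
  intro h0
  have h1 := curve_unique h.one_add (Delta_curve K φ)
    ((mul_comm _ _).trans (Delta_curve K ψ)) h0
  refine hne (cos_allowed_inj hφ hψ (cos_eq_of_Lam_eq h.ne_zero (h.allowed hφ) ?_))
  rw [Lam, Lam, h0, h1, mul_comm]

theorem distinctPoles {M n : ℕ} {K : ℂ} (h : Generic M K) {φ : Fin n → ℂ}
    (hφ : ∀ k, φ k ∈ allowedPhases M) (hinj : Function.Injective φ) :
    DistinctPoles (fun k => Delta K (φ k)) (fun k => DeltaStar K (φ k)) where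
  left k l hkl := by
    by_contra hne
    exact Delta_ne_Delta h (hφ k) (hφ l) (fun h => hne (hinj h)) hkl
  right k l hkl := by
    by_contra hne
    exact DeltaStar_ne_DeltaStar h (hφ k) (hφ l) (fun h => hne (hinj h)) hkl
  ne k l := Delta_ne_DeltaStar h (hφ k) (hφ l)

/-! ### Tau-functions -/

theorem tau_eq_hirotaTau (K : ℂ) {n : ℕ} (m : ℕ) : ∀ (f φ : Fin n → ℂ),
    tau K n f φ m = hirotaTau n (fun k => Delta K (φ k)) (fun k => DeltaStar K (φ k))
      (fun k => f k * Complex.exp (2 * Complex.I * φ k) ^ m) := by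
  induction n with
  | zero => intro f φ; rfl
  | succ n ih =>
    intro f φ
    rw [tau, hirotaTau, ih, ih, ← Complex.exp_nat_mul]
    simp only [phaseShift_eq]
    congr 2
    · congr 2; ring
    · congr 1; funext k; ring

theorem tau_add_period {K : ℂ} {M : ℕ} (hM : 0 < M) {n : ℕ} {f φ : Fin n → ℂ}
    (hφ : ∀ k, φ k ∈ allowedPhases M) (m : ℕ) : tau K n f φ (m + M) = tau K n f φ m := by
  rw [tau_eq_hirotaTau, tau_eq_hirotaTau]
  simp only [pow_add, exp_allowed hM (hφ _), mul_one]

theorem Theta_add_period {K : ℂ} {M : ℕ} (hM : 0 < M) {n : ℕ} {f φ : Fin n → ℂ}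
    (hφ : ∀ k, φ k ∈ allowedPhases M) (m : ℕ) : Theta K n f φ (m + M) = Theta K n f φ m :=
  tau_add_period hM hφ m

/-- Removing an arbitrary soliton from the tau-function. -/
theorem tau_succAbove (K : ℂ) {n : ℕ} (f φ : Fin (n + 1) → ℂ) (m : ℕ) (j : Fin (n + 1)) :
    tau K (n + 1) f φ m =
      tau K n (fun k => f (j.succAbove k)) (fun k => φ (j.succAbove k)) m +
        f j * Complex.exp (2 * Complex.I * φ j) ^ m *
          tau K n (fun k => phaseShift K (φ (j.succAbove k)) (φ j) * f (j.succAbove k))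
            (fun k => φ (j.succAbove k)) m := by
  rw [tau_eq_hirotaTau, tau_eq_hirotaTau, tau_eq_hirotaTau, hirotaTau_succAbove _ _ _ j]
  simp only [phaseShift_eq]
  congr 2
  congr 1
  funext k
  ring

/-! ### Linearization of the cyclic Darboux transformation -/

/-- The Darboux relation at one site, solved for the new parameters. -/
theorem darboux_site_iff {K D L U W Ua Wa Ub Wb U' W' : ℂ} (hK : K ≠ 0) (hD : D ≠ 0)
    (hL : L ≠ 0) (hU : U ≠ 0) (hW : W ≠ 0) (hUa : Ua ≠ 0) (hWa : Wa ≠ 0) :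
    (∀ Λ : ℂ, Λ ≠ 0 → laxAux (K / D) L Λ Ua Wa * laxL K Λ U W =
        laxL K Λ U' W' * laxAux (K / D) L Λ Ub Wb) ↔
      Ub ≠ 0 ∧ Wb ≠ 0 ∧ L * U = Ub * (L + Ua * W + K * U * W) ∧
        Wb * (L + Ua * W) = D * (U * W) ∧ U' = Ua / D ∧ W' = Wa * (L + Ua * W) / Ua := by
  constructor
  · intro h
    -- The entries used are polynomials of degree at most 2 in Λ⁻¹, so the values at Λ = ±1 separate
    -- even from odd coefficients. This suffices to determine everything.
    have e1 := h 1 one_ne_zero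
    have e2 := h (-1) (by norm_num)
    have a1 := congrFun (congrFun e1 1) 0
    have a2 := congrFun (congrFun e2 1) 0
    have b1 := congrFun (congrFun e1 1) 1
    have c1 := congrFun (congrFun e1 0) 1
    have c2 := congrFun (congrFun e2 0) 1
    simp only [laxAux, laxL, Matrix.mul_apply, Fin.sum_univ_two, Matrix.of_apply,
      Matrix.cons_val', Matrix.cons_val_zero, Matrix.cons_val_one, Matrix.cons_val_fin_one,
      div_one, div_neg, mul_zero, add_zero, zero_mul] at a1 a2 b1 c1 c2
    have h21 : L * (Wa / Ua) + Wa * W = W' := by linear_combination (a1 + a2) / 2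
    have h21' : L * (Wa / Ua) * (K * (U * W)) = W' * (K / D * L * Wb) := by
      linear_combination (a1 - a2) / 2
    have h22 : L * (Wa / Ua) * U = W' * (Ub * (1 + K / D * Wb)) := b1
    have h12 : K / D * L * Wa * U = K * (U' * W') * (Ub * (1 + K / D * Wb)) := by
      linear_combination (c1 + c2) / 2
    have hne : W' * (Ub * (1 + K / D * Wb)) ≠ 0 := by
      rw [← h22]
      exact mul_ne_zero (mul_ne_zero hL (div_ne_zero hWa hUa)) hU
    have hW' : W' ≠ 0 := left_ne_zero_of_mul hne
    have hUb : Ub ≠ 0 := left_ne_zero_of_mul (right_ne_zero_of_mul hne)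
    have hW'eq : W' = Wa * (L + Ua * W) / Ua := by
      rw [← h21]; field_simp
    have hs : L + Ua * W ≠ 0 := by
      intro h0
      rw [h0] at hW'eq
      simp [hW'] at hW'eq
    have hWb : Wb * (L + Ua * W) = D * (U * W) := by
      rw [hW'eq] at h21'
      field_simp at h21'
      have h3 : (K * L * Wa) * (Wb * (L + Ua * W)) = (K * L * Wa) * (D * (U * W)) := by
        linear_combination -(K * L * Wa) * h21'
      exact mul_left_cancel₀ (mul_ne_zero (mul_ne_zero hK hL) hWa) h3
    refine ⟨hUb, ?_, ?_, hWb, ?_, hW'eq⟩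
    · intro h0
      rw [h0, zero_mul] at hWb
      exact mul_ne_zero hD (mul_ne_zero hU hW) hWb.symm
    · rw [hW'eq] at h22
      have h3 : L * (Wa / Ua) * U = Wa / Ua * Ub * (L + Ua * W + K / D * (D * (U * W))) := by
        rw [h22, ← hWb]; ring
      have h4 : Wa / Ua * (L * U) = Wa / Ua * (Ub * (L + Ua * W + K * U * W)) := by
        have h5 : K / D * (D * (U * W)) = K * U * W := by field_simp
        rw [h5] at h3
        linear_combination h3
      exact mul_left_cancel₀ (div_ne_zero hWa hUa) h4
    · have h3 : K / D * L * Wa * U = K * U' * (L * (Wa / Ua) * U) := by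
        rw [h22, h12]; ring
      field_simp at h3
      field_simp
      linear_combination -h3
  · rintro ⟨hUb, hWb, h1, h2, rfl, rfl⟩ Λ hΛ
    have hs : L + Ua * W ≠ 0 := by
      intro h0
      rw [h0, mul_zero] at h2
      exact mul_ne_zero hD (mul_ne_zero hU hW) h2.symm
    have hs' : L + Ua * W + K * U * W ≠ 0 := by
      intro h0
      rw [h0, mul_zero] at h1
      exact mul_ne_zero hL hU h1
    obtain rfl : Wb = D * (U * W) / (L + Ua * W) := by rw [← h2, mul_div_cancel_right₀ _ hs]
    obtain rfl : Ub = L * U / (L + Ua * W + K * U * W) := by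
      rw [h1, mul_div_cancel_right₀ _ hs']
    generalize hS : L + Ua * W = S at *
    obtain rfl : L = S - Ua * W := by rw [← hS]; ring
    have hs₁ : S + K * W * U ≠ 0 := by rwa [mul_right_comm]
    have hs₂ : S + W * U * K ≠ 0 := by rwa [mul_comm (W * U) K, ← mul_assoc]
    ext i j
    fin_cases i <;> fin_cases j <;>
      simp only [laxAux, laxL, Matrix.mul_apply, Fin.sum_univ_two, Matrix.of_apply,
        Matrix.cons_val', Matrix.cons_val_zero, Matrix.cons_val_one, Matrix.cons_val_fin_one,
        mul_zero, add_zero, Fin.zero_eta, Fin.mk_one] <;>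
      field_simp <;> ring

/-- The linear problem for the tau-functions `T`, `Θ` at the spectral parameter `L`. -/
def LinSol (K L : ℂ) (T Θ P R : ℕ → ℂ) : Prop :=
  ∀ i, L * P (i + 1) * Θ i - P i * Θ (i + 1) = T i * R (i + 1) ∧
    L * Θ i * P (i + 2) = T (i + 1) * R (i + 1) - K * Θ (i + 1) * P (i + 1)

/-- Cyclic solutions of the Darboux relation are the nowhere vanishing quasi-periodic solutions of
the linear problem. -/
theorem cyclicDarboux_iff {N M : ℕ} (hN : 0 < N) (hM : 0 < M) {κ φ : ℂ} (hκ : κ ≠ 0)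
    {T Θ : ℕ → ℂ} (hT : ∀ i, T i ≠ 0) (hΘ : ∀ i, Θ i ≠ 0) (hTp : ∀ i, T (i + M) = T i)
    (hΘp : ∀ i, Θ (i + M) = Θ i) {ε : ℂ} (hε : ε * ε = 1) {u w u' w' : Fin M → ℂ}
    (hu : ∀ i : Fin M, u i ^ N = -ε * (T i / T (i + 1)))
    (hw : ∀ i : Fin M, w i ^ N = ε * (Θ (i + 1) / Θ i)) :
    CyclicDarboux N M κ φ u w u' w' ↔
      ∃ (P R : ℕ → ℂ) (μ : ℂ), (∀ i, P i ≠ 0 ∧ R i ≠ 0) ∧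
        LinSol (κ ^ N) (Lam (κ ^ N) φ) T Θ P R ∧
        (∀ i, P (i + M) = μ * P i ∧ R (i + M) = μ * R i) ∧
        ∀ i : Fin M, u' i ^ N = -ε * (P i / (Delta (κ ^ N) φ * P (i + 1))) ∧
          w' i ^ N = ε * (Delta (κ ^ N) φ * R (i + 1) / R i) := by
  set K := κ ^ N with hKdef
  have hK : K ≠ 0 := pow_ne_zero _ hκ
  set D := Delta K φ with hDdef
  have hD : D ≠ 0 := Delta_ne_zero hK φ
  set L := Lam K φ with hLdef
  have hL : L ≠ 0 := Lam_ne_zero hK φ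
  have hε0 : ε ≠ 0 := left_ne_zero_of_mul (hε.trans_ne one_ne_zero)
  have hu0 : ∀ i, u i ^ N ≠ 0 := fun i => by
    rw [hu]; exact mul_ne_zero (neg_ne_zero.2 hε0) (div_ne_zero (hT _) (hT _))
  have hw0 : ∀ i, w i ^ N ≠ 0 := fun i => by
    rw [hw]; exact mul_ne_zero hε0 (div_ne_zero (hΘ _) (hΘ _))
  constructor
  · rintro ⟨uφ, wφ, hne, hdar, hucyc, hwcyc⟩
    -- The cyclic conditions allow the auxiliary powers to be extended to `M`-periodic sequences on
    -- ℕ.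
    set V : ℕ → ℂ := fun i => uφ ⟨i % M, (Nat.mod_lt i hM).trans (Nat.lt_succ_self M)⟩ ^ N
      with hV
    set X : ℕ → ℂ := fun i => wφ ⟨i % M, (Nat.mod_lt i hM).trans (Nat.lt_succ_self M)⟩ ^ N
      with hX
    have hV0 : ∀ i, V i ≠ 0 := fun i => pow_ne_zero _ (hne _).1
    have hX0 : ∀ i, X i ≠ 0 := fun i => pow_ne_zero _ (hne _).2
    have hVp : ∀ i, V (i + M) = V i := fun i => by simp only [hV, Nat.add_mod_right]
    have hXp : ∀ i, X (i + M) = X i := fun i => by simp only [hX, Nat.add_mod_right]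
    have hVc : ∀ i : Fin M, uφ i.castSucc ^ N = V i ∧ wφ i.castSucc ^ N = X i := fun i => by
      have : (⟨(i : ℕ) % M, (Nat.mod_lt i hM).trans (Nat.lt_succ_self M)⟩ : Fin (M + 1)) =
          i.castSucc := Fin.ext (Nat.mod_eq_of_lt i.2)
      simp only [hV, hX, this, and_self]
    have hVs : ∀ i : Fin M, uφ i.succ ^ N = V (i + 1) ∧ wφ i.succ ^ N = X (i + 1) := fun i => by
      rcases Nat.lt_or_ge ((i : ℕ) + 1) M with hi | hi
      · have : (⟨((i : ℕ) + 1) % M, (Nat.mod_lt _ hM).trans (Nat.lt_succ_self M)⟩ :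
            Fin (M + 1)) = i.succ := Fin.ext (Nat.mod_eq_of_lt hi)
        simp only [hV, hX, this, and_self]
      · have hi' : (i : ℕ) + 1 = M := le_antisymm i.2 hi
        have h1 : (⟨((i : ℕ) + 1) % M, (Nat.mod_lt _ hM).trans (Nat.lt_succ_self M)⟩ :
            Fin (M + 1)) = 0 := Fin.ext (by simp [hi'])
        have h2 : i.succ = Fin.last M := Fin.ext (by simp [hi'])
        simp only [hV, hX, h1, h2, hucyc, hwcyc, and_self]
    have hsite := fun i : Fin M =>
      (darboux_site_iff (Ub := uφ i.succ ^ N) (Wb := wφ i.succ ^ N) (U' := u' i ^ N)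
        (W' := w' i ^ N) hK hD hL (hu0 i) (hw0 i)
        (pow_ne_zero N (hne i.castSucc).1) (pow_ne_zero N (hne i.castSucc).2)).1 (hdar i)
    simp only [fun i => (hVc i).1, fun i => (hVc i).2, fun i => (hVs i).1, fun i => (hVs i).2]
      at hsite
    have hTm : ∀ i, T (i % M) = T i ∧ T (i % M + 1) = T (i + 1) ∧ Θ (i % M) = Θ i ∧
        Θ (i % M + 1) = Θ (i + 1) ∧ V (i % M) = V i ∧ V (i % M + 1) = V (i + 1) ∧
        X (i % M) = X i ∧ X (i % M + 1) = X (i + 1) := by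
      have gen : ∀ F : ℕ → ℂ, (∀ i, F (i + M) = F i) → ∀ i, F (i % M) = F i := by
        intro F hF i
        exact (Function.Periodic.map_mod_nat (f := F) hF i)
      have gen' : ∀ F : ℕ → ℂ, (∀ i, F (i + M) = F i) → ∀ i, F (i % M + 1) = F (i + 1) := by
        intro F hF i
        exact gen (fun i => F (i + 1)) (fun i => by rw [add_right_comm]; exact hF _) i
      intro i
      exact ⟨gen T hTp i, gen' T hTp i, gen Θ hΘp i, gen' Θ hΘp i, gen V hVp i, gen' V hVp i,
        gen X hXp i, gen' X hXp i⟩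
    have hric : ∀ i, L * (-ε * (T i / T (i + 1))) = V (i + 1) *
        (L + V i * (ε * (Θ (i + 1) / Θ i)) +
          K * (-ε * (T i / T (i + 1))) * (ε * (Θ (i + 1) / Θ i))) := by
      intro i
      have := (hsite ⟨i % M, Nat.mod_lt i hM⟩).2.2.1
      obtain ⟨h1, h2, h3, h4, h5, h6, -, -⟩ := hTm i
      rw [hu, hw] at this
      simpa only [h1, h2, h3, h4, h5, h6] using this
    have hXe : ∀ i, X (i + 1) * (L + V i * (ε * (Θ (i + 1) / Θ i))) =
        D * ((-ε * (T i / T (i + 1))) * (ε * (Θ (i + 1) / Θ i))) := by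
      intro i
      have := (hsite ⟨i % M, Nat.mod_lt i hM⟩).2.2.2.1
      obtain ⟨h1, h2, h3, h4, h5, h6, h7, h8⟩ := hTm i
      rw [hu, hw] at this
      simpa only [h1, h2, h3, h4, h5, h6, h7, h8] using this
    -- `P` solves V_i = -ε P_i / P_(i+1) with P_0 = 1. This substitution linearizes the Möbius
    -- recursion for `V`, and the periodicity of `V` becomes quasi-periodicity of `P` with
    -- multiplier P_M.
    set P : ℕ → ℂ := fun i => Nat.rec 1 (fun k x => -ε * x / V k) i with hP
    have hPs : ∀ i, P (i + 1) = -ε * P i / V i := fun i => rfl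
    have hP0 : ∀ i, P i ≠ 0 := by
      intro i
      induction i with
      | zero => exact one_ne_zero
      | succ i ih => rw [hPs]; exact div_ne_zero (mul_ne_zero (neg_ne_zero.2 hε0) ih) (hV0 i)
    have hPV : ∀ i, V i = -ε * P i / P (i + 1) := by
      intro i
      have := hP0 i
      have := hV0 i
      rw [hPs]; field_simp
    have hPp : ∀ i, P (i + M) = P M * P i := by
      intro i
      induction i with
      | zero => rw [zero_add, show P 0 = 1 from rfl, mul_one]
      | succ i ih => rw [add_right_comm, hPs, hPs, ih, hVp]; ring
    have hS : ∀ i, L + V i * (ε * (Θ (i + 1) / Θ i)) =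
        (L * P (i + 1) * Θ i - P i * Θ (i + 1)) / (P (i + 1) * Θ i) := by
      intro i
      have h3 := hΘ i
      have h6 := hP0 (i + 1)
      rw [hPV]
      field_simp
      linear_combination -(P i * Θ (i + 1)) * hε
    -- The choice of `R` encodes `X`. The formula for `X (i + 1)` then becomes the first linear
    -- equation, and the recursion for `V` the second.
    set R : ℕ → ℂ := fun i => -D * P i * Θ i / (T i * X i) with hR
    have hR0 : ∀ i, R i ≠ 0 := fun i =>
      div_ne_zero (mul_ne_zero (mul_ne_zero (neg_ne_zero.2 hD) (hP0 i)) (hΘ i))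
        (mul_ne_zero (hT i) (hX0 i))
    have hQ : ∀ i, L * P (i + 1) * Θ i - P i * Θ (i + 1) = T i * R (i + 1) := by
      intro i
      have h := hXe i
      have h1 := hT i
      have h2 := hT (i + 1)
      have h3 := hΘ i
      have h6 := hP0 (i + 1)
      have h7 := hX0 (i + 1)
      rw [hS] at h
      generalize L * P (i + 1) * Θ i - P i * Θ (i + 1) = Q at h ⊢
      field_simp at h
      simp only [hR]
      field_simp
      linear_combination h - D * T i * Θ (i + 1) * P (i + 1) * hε
    refine ⟨P, R, P M, fun i => ⟨hP0 i, hR0 i⟩, fun i => ⟨hQ i, ?_⟩,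
      fun i => ⟨hPp i, ?_⟩, fun i => ⟨?_, ?_⟩⟩
    · have h := hric i
      have h1 := hT i
      have h2 := hT (i + 1)
      have h3 := hΘ i
      have h6 := hP0 (i + 1)
      have h6' := hP0 (i + 2)
      rw [hS, hQ, hPV (i + 1), show i + 1 + 1 = i + 2 from rfl] at h
      field_simp at h
      linear_combination -h - K * P (i + 1) * Θ (i + 1) * hε
    · simp only [hR, hPp, hΘp, hTp, hXp]; ring
    · rw [(hsite i).2.2.2.2.1, hPV]
      have := hP0 (i + 1)
      field_simp
    · rw [(hsite i).2.2.2.2.2, hw, hS, hQ, hPV]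
      have h1 := hT i
      have h3 := hΘ i
      have h5 := hP0 i
      have h6 := hP0 (i + 1)
      have h7 := hX0 i
      rw [show R i = -D * P i * Θ i / (T i * X i) from rfl]
      field_simp
      linear_combination R (i + 1) * hε
  · rintro ⟨P, R, μ, hne, hlin, hper, hst⟩
    have hroot : ∀ x : ℂ, ∃ y, y ^ N = x := fun x => IsAlgClosed.exists_pow_nat_eq x hN
    -- One root function is used at all sites, so equality of the powers `V M = V 0`, `X M = X 0`
    -- gives equality of the auxiliary parameters themselves.
    choose r hr using hroot
    set V : ℕ → ℂ := fun i => -ε * (P i / P (i + 1)) with hV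
    set X : ℕ → ℂ := fun i => -D * (P i * Θ i / (T i * R i)) with hX
    have hV0 : ∀ i, V i ≠ 0 := fun i =>
      mul_ne_zero (neg_ne_zero.2 hε0) (div_ne_zero (hne _).1 (hne _).1)
    have hX0 : ∀ i, X i ≠ 0 := fun i => mul_ne_zero (neg_ne_zero.2 hD)
      (div_ne_zero (mul_ne_zero (hne _).1 (hΘ _)) (mul_ne_zero (hT _) (hne _).2))
    have hr0 : ∀ x : ℂ, x ≠ 0 → r x ≠ 0 := fun x hx h0 => hx (by rw [← hr x, h0, zero_pow hN.ne'])
    have hμ : μ ≠ 0 := fun h0 => (hne (0 + M)).1 (by rw [(hper 0).1, h0, zero_mul])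
    have hVM : V M = V 0 := by
      have h1 := (hper 0).1
      have h2 := (hper 1).1
      rw [zero_add] at h1
      rw [add_comm] at h2
      simp only [hV, h1, h2, zero_add]
      rw [mul_div_mul_left _ _ hμ]
    have hXM : X M = X 0 := by
      have h1 := hper 0
      have h2 := hΘp 0
      have h3 := hTp 0
      rw [zero_add] at h1 h2 h3
      simp only [hX, h1, h2, h3]
      rw [mul_assoc, mul_left_comm (T 0), mul_div_mul_left _ _ hμ]
    refine ⟨fun i => r (V i), fun i => r (X i), fun i => ⟨hr0 _ (hV0 _), hr0 _ (hX0 _)⟩, ?_, ?_, ?_⟩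
    · intro i
      simp only [hr, Fin.val_castSucc, Fin.val_succ]
      rw [darboux_site_iff hK hD hL (hu0 i) (hw0 i) (hV0 _) (hX0 _)]
      obtain ⟨e1, e2⟩ := hlin i
      have h1 := hT i
      have h2 := hT (i + 1)
      have h3 := hΘ i
      have h4 := hΘ (i + 1)
      have h5 := (hne i).1
      have h6 := (hne (i + 1)).1
      have h6' := (hne (i + 1 + 1)).1
      have h7 := (hne i).2
      have h8 := (hne (i + 1)).2
      have hVW : L + V i * w i ^ N = T i * R (i + 1) / (P (i + 1) * Θ i) := by
        rw [hw, ← e1]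
        simp only [hV]
        field_simp
        linear_combination -(P i * Θ (i + 1)) * hε
      refine ⟨hV0 _, hX0 _, ?_, ?_, ?_, ?_⟩
      · rw [show L + V i * w i ^ N + K * u i ^ N * w i ^ N =
          T i / (T (i + 1) * Θ i) * (L * Θ i * P (i + 2)) / P (i + 1) by
            rw [e2, hVW, hu, hw]; field_simp; linear_combination -(K * P (i + 1) * Θ (i + 1)) * hε]
        rw [hu]
        simp only [hV]
        field_simp
      · rw [hVW, hu, hw]
        simp only [hX]
        field_simp
        linear_combination hε
      · rw [(hst i).1]
        simp only [hV]
        field_simp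
      · rw [(hst i).2, hVW]
        simp only [hV, hX]
        field_simp
        linear_combination hε
    · simp only [Fin.val_last, hVM, Fin.val_zero]
    · simp only [Fin.val_last, hXM, Fin.val_zero]

/-! ### Soliton states -/

theorem omegaInvSqrt_pow {N : ℕ} (hN : 0 < N) : omegaInvSqrt N ^ N = -1 := by
  have hN' : (N : ℂ) ≠ 0 := by exact_mod_cast hN.ne'
  rw [omegaInvSqrt, ← Complex.exp_nat_mul,
    show (N : ℂ) * -((Real.pi : ℂ) * Complex.I / N) = -(Real.pi * Complex.I) by field_simp,
    Complex.exp_neg, Complex.exp_pi_mul_I]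
  norm_num

theorem neg_one_pow_mul_self (N : ℕ) : (-1 : ℂ) ^ N * (-1) ^ N = 1 := by
  rw [← mul_pow]; simp

namespace SolitonState

variable {N M : ℕ} {κ : ℂ} {n : ℕ} {f φ : Fin n → ℂ}

theorem u_pow (hN : 0 < N) (s : SolitonState N M κ f φ) (i : Fin M) :
    s.u i ^ N = -(-1) ^ N * (tau (κ ^ N) n f φ i / tau (κ ^ N) n f φ (i + 1)) := by
  rw [SolitonState.u, mul_pow, neg_pow, omegaInvSqrt_pow hN, div_pow, s.τ_pow, s.τ_pow]
  ring

theorem w_pow (s : SolitonState N M κ f φ) (i : Fin M) :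
    s.w i ^ N = (-1) ^ N * (Theta (κ ^ N) n f φ (i + 1) / Theta (κ ^ N) n f φ i) := by
  rw [SolitonState.w, neg_pow, div_pow, s.θ_pow, s.θ_pow]

theorem tau_ne_zero (s : SolitonState N M κ f φ) (m : ℕ) : tau (κ ^ N) n f φ m ≠ 0 := by
  rw [← s.τ_pow]; exact pow_ne_zero _ (s.τ_ne_zero _)

theorem Theta_ne_zero (s : SolitonState N M κ f φ) (m : ℕ) : Theta (κ ^ N) n f φ m ≠ 0 := by
  rw [← s.θ_pow]; exact pow_ne_zero _ (s.θ_ne_zero _)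

end SolitonState

/-- Roots are chosen at the representatives `ZMod.val`. Since the phases are allowed, the
tau-functions are `M`-periodic and the root relations hold at every index. -/
theorem exists_solitonState {N M : ℕ} (hN : 0 < N) (hM : 0 < M) {κ : ℂ} {n : ℕ} {f φ : Fin n → ℂ}
    (hφ : ∀ k, φ k ∈ allowedPhases M) (hinj : Function.Injective φ)
    (hT : ∀ m, tau (κ ^ N) n f φ m ≠ 0) (hΘ : ∀ m, Theta (κ ^ N) n f φ m ≠ 0) :
    Nonempty (SolitonState N M κ f φ) := by
  have hroot : ∀ x : ℂ, ∃ y, y ^ N = x := fun x => IsAlgClosed.exists_pow_nat_eq x hN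
  choose r hr using hroot
  have hr0 : ∀ x : ℂ, x ≠ 0 → r x ≠ 0 := fun x hx h0 => hx (by rw [← hr x, h0, zero_pow hN.ne'])
  have hmod : ∀ F : ℕ → ℂ, (∀ i, F (i + M) = F i) → ∀ i : ℕ, F ((i : ZMod M).val) = F i := by
    intro F hF i
    rw [ZMod.val_natCast]
    exact Function.Periodic.map_mod_nat (f := F) hF i
  exact ⟨{ phase_mem := hφ
           phase_injective := hinj
           τ := fun x => r (tau (κ ^ N) n f φ x.val)
           θ := fun x => r (Theta (κ ^ N) n f φ x.val)
           τ_ne_zero := fun m => hr0 _ (hT _)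
           θ_ne_zero := fun m => hr0 _ (hΘ _)
           τ_pow := fun m => by rw [hr]; exact hmod _ (tau_add_period hM hφ) m
           θ_pow := fun m => by rw [hr]; exact hmod _ (Theta_add_period hM hφ) m }⟩

theorem inState_iff {N M : ℕ} {κ : ℂ} {n : ℕ} {f φ : Fin n → ℂ} {u w : Fin M → ℂ}
    {s : SolitonState N M κ f φ} : InState u w s ↔ InStateUpToGauge 1 u w s := by
  simp [InState, InStateUpToGauge]

/-- The chain of a state that is a solution of the linear problem is produced by a cyclic
solution. -/
theorem cyclicDarboux_of_state {N M : ℕ} (hN : 0 < N) (hM : 0 < M) {κ φ : ℂ} (hκ : κ ≠ 0)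
    {n n' : ℕ} {f φs : Fin n → ℂ} {f' φs' : Fin n' → ℂ} (s : SolitonState N M κ f φs)
    (s' : SolitonState N M κ f' φs') {a b : ℂ} (ha : a ≠ 0) (hb : b ≠ 0)
    (hlin : LinSol (κ ^ N) (Lam (κ ^ N) φ) (tau (κ ^ N) n f φs) (Theta (κ ^ N) n f φs)
      (fun m => a⁻¹ ^ m * tau (κ ^ N) n' f' φs' m)
      (fun m => b * (a⁻¹ ^ m * Theta (κ ^ N) n' f' φs' m)))
    {u' w' : Fin M → ℂ} (h : InStateUpToGauge (a / Delta (κ ^ N) φ) u' w' s') :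
    CyclicDarboux N M κ φ s.u s.w u' w' := by
  have hD := Delta_ne_zero (pow_ne_zero N hκ) φ
  rw [cyclicDarboux_iff hN hM hκ s.tau_ne_zero s.Theta_ne_zero
    (tau_add_period hM s.phase_mem) (Theta_add_period hM s.phase_mem)
    (neg_one_pow_mul_self N) (s.u_pow hN) s.w_pow]
  have hai := inv_ne_zero ha
  refine ⟨_, _, a⁻¹ ^ M, fun i => ⟨mul_ne_zero (pow_ne_zero _ hai) (s'.tau_ne_zero i),
    mul_ne_zero hb (mul_ne_zero (pow_ne_zero _ hai) (s'.Theta_ne_zero i))⟩, hlin,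
    fun i => ⟨?_, ?_⟩, fun i => ⟨?_, ?_⟩⟩
  · rw [tau_add_period hM s'.phase_mem]; ring
  · rw [Theta_add_period hM s'.phase_mem]; ring
  · rw [(h i).1, s'.u_pow hN]
    have := s'.tau_ne_zero i
    have := s'.tau_ne_zero (i + 1)
    simp only [inv_pow, pow_succ]
    field_simp
  · rw [(h i).2, s'.w_pow]
    have := s'.Theta_ne_zero i
    have := s'.Theta_ne_zero (i + 1)
    simp only [inv_pow, pow_succ]
    field_simp

/-- If a nowhere vanishing quasi-periodic solution of the linear problem is given by tau-functions,
the corresponding chain is in the corresponding state. -/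
theorem exists_state_of_linSol {N M : ℕ} (hN : 0 < N) (hM : 0 < M) {κ L D : ℂ} (hD : D ≠ 0)
    {n' : ℕ} {f' φs' : Fin n' → ℂ} (hφ : ∀ k, φs' k ∈ allowedPhases M)
    (hinj : Function.Injective φs') {a b : ℂ} (ha : a ≠ 0) (hb : b ≠ 0) {T Θ : ℕ → ℂ}
    (hT : ∀ i, T i ≠ 0)
    (hlin : LinSol (κ ^ N) L T Θ (fun m => a⁻¹ ^ m * tau (κ ^ N) n' f' φs' m)
      (fun m => b * (a⁻¹ ^ m * Theta (κ ^ N) n' f' φs' m)))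
    {P R : ℕ → ℂ} {μ : ℂ} (hne : ∀ i, P i ≠ 0 ∧ R i ≠ 0) (hPR : LinSol (κ ^ N) L T Θ P R)
    (hper : ∀ i, P (i + M) = μ * P i ∧ R (i + M) = μ * R i) {u' w' : Fin M → ℂ}
    (hst : ∀ i : Fin M, u' i ^ N = -(-1) ^ N * (P i / (D * P (i + 1))) ∧
      w' i ^ N = (-1) ^ N * (D * R (i + 1) / R i)) {A : ℂ}
    (hA : ∀ m, P m = A * (a⁻¹ ^ m * tau (κ ^ N) n' f' φs' m)) :
    ∃ s' : SolitonState N M κ f' φs', InStateUpToGauge (a / D) u' w' s' := by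
  have hA0 : A ≠ 0 := fun h0 => (hne 0).1 (by rw [hA, h0, zero_mul])
  have hai := inv_ne_zero ha
  have hT' : ∀ m, tau (κ ^ N) n' f' φs' m ≠ 0 := fun m h0 => (hne m).1 (by rw [hA, h0]; ring)
  -- The first linear equation determines `R (m + 1)` from `P`, but it says nothing about `R 0`.
  -- That value is recovered below from `R M` by quasi-periodicity.
  have hR1 : ∀ m, R (m + 1) = A * (b * (a⁻¹ ^ (m + 1) * Theta (κ ^ N) n' f' φs' (m + 1))) := by
    intro m
    apply mul_left_cancel₀ (hT m)
    rw [← (hPR m).1, mul_left_comm, ← (hlin m).1, hA, hA]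
    ring
  have hμ : μ = a⁻¹ ^ M := by
    have := (hper 0).1
    rw [hA, hA, tau_add_period hM hφ, zero_add, pow_zero] at this
    apply mul_right_cancel₀ (mul_ne_zero hA0 (hT' 0))
    linear_combination -this
  have hR : ∀ m, R m = A * (b * (a⁻¹ ^ m * Theta (κ ^ N) n' f' φs' m)) := by
    intro m
    cases m with
    | succ m => exact hR1 m
    | zero =>
      apply mul_left_cancel₀ (pow_ne_zero M hai)
      rw [← hμ, ← (hper 0).2, hμ, zero_add]
      obtain ⟨M', rfl⟩ : ∃ k, M = k + 1 := ⟨M - 1, by omega⟩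
      have h0 := Theta_add_period (K := κ ^ N) (f := f') hM hφ 0
      rw [zero_add] at h0
      rw [hR1, h0]
      ring
  have hΘ' : ∀ m, Theta (κ ^ N) n' f' φs' m ≠ 0 := fun m h0 => (hne m).2 (by rw [hR, h0]; ring)
  obtain ⟨s'⟩ := exists_solitonState hN hM hφ hinj hT' hΘ'
  refine ⟨s', fun i => ⟨?_, ?_⟩⟩
  · rw [(hst i).1, s'.u_pow hN, hA, hA]
    have := hT' i
    have := hT' (i + 1)
    simp only [inv_pow, pow_succ]
    field_simp
  · rw [(hst i).2, s'.w_pow, hR, hR]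
    have := hΘ' i
    have := hΘ' (i + 1)
    simp only [inv_pow, pow_succ]
    field_simp

/-! ### Solutions of the linear problem -/

/-- The tau-function with amplitudes shifted by the point `z`; for `z = Δ*(φ)` the shift is
`s(·, φ)`. -/
def shiftAmp (K : ℂ) {n : ℕ} (f φ : Fin n → ℂ) (z : ℂ) (k : Fin n) : ℂ :=
  f k * (DeltaStar K (φ k) / Delta K (φ k) *
    vertex (Delta K (φ k)) (DeltaStar K (φ k)) z)

theorem shiftAmp_DeltaStar (K : ℂ) {n : ℕ} (f φs : Fin n → ℂ) (φ : ℂ) :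
    shiftAmp K f φs (DeltaStar K φ) = fun k => f k * sFun K (φs k) φ := rfl

theorem shiftAmp_Delta (K : ℂ) {n : ℕ} (f φs : Fin n → ℂ) (φ : ℂ) :
    shiftAmp K f φs (Delta K φ) = fun k => f k * sFun K (φs k) (-φ) := by
  rw [← DeltaStar_neg]; rfl

/-- The point of the curve with first coordinate -K has second coordinate 0. -/
theorem ne_neg_of_curve {K x y : ℂ} (hK1 : 1 + K ≠ 0) (h : (x - 1) * (y - 1) = 1 + K)
    (hy : y ≠ 0) : x ≠ -K := by
  rintro rfl
  apply hy
  have : (1 + K) * y = 0 := by linear_combination -h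
  exact (mul_eq_zero.1 this).resolve_left hK1

section Tau

variable {M : ℕ} {K : ℂ} {n : ℕ} {f φ : Fin n → ℂ}

/-- All tau-functions of the linear problem are written over one base amplitude with vertex factors
inserted, so that the three-term relation applies. The factor at 0 is Δ/Δ*, which undoes the
normalization of the base. -/
theorem tau_eq_base (hK : K ≠ 0) (m : ℕ) : tau K n f φ m =
    hirotaTau n (fun k => Delta K (φ k)) (fun k => DeltaStar K (φ k))
      (fun k => f k * (DeltaStar K (φ k) / Delta K (φ k)) *
        Complex.exp (2 * Complex.I * φ k) ^ m *
        vertex (Delta K (φ k)) (DeltaStar K (φ k)) 0) := by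
  rw [tau_eq_hirotaTau]
  congr 1
  funext k
  have := Delta_ne_zero hK (φ k)
  have := DeltaStar_ne_zero hK (φ k)
  rw [vertex_zero]
  field_simp

/-- Since the vertex factor at 0 is e^(2iφ_k), the step m ↦ m + 1 inserts one more such factor. -/
theorem tau_succ_eq_base (hK : K ≠ 0) (m : ℕ) : tau K n f φ (m + 1) =
    hirotaTau n (fun k => Delta K (φ k)) (fun k => DeltaStar K (φ k))
      (fun k => f k * (DeltaStar K (φ k) / Delta K (φ k)) *
        Complex.exp (2 * Complex.I * φ k) ^ m *
        (vertex (Delta K (φ k)) (DeltaStar K (φ k)) 0 *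
          vertex (Delta K (φ k)) (DeltaStar K (φ k)) 0)) := by
  rw [tau_eq_base hK]
  congr 1
  funext k
  rw [pow_succ, ← Delta_div_DeltaStar hK, vertex_zero]
  ring

theorem shiftTau_eq_base (z : ℂ) (m : ℕ) : tau K n (shiftAmp K f φ z) φ m =
    hirotaTau n (fun k => Delta K (φ k)) (fun k => DeltaStar K (φ k))
      (fun k => f k * (DeltaStar K (φ k) / Delta K (φ k)) *
        Complex.exp (2 * Complex.I * φ k) ^ m *
        vertex (Delta K (φ k)) (DeltaStar K (φ k)) z) := by
  rw [tau_eq_hirotaTau]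
  congr 1
  funext k
  rw [shiftAmp]
  ring

theorem shiftTau_succ_eq_base (hK : K ≠ 0) (z : ℂ) (m : ℕ) :
    tau K n (shiftAmp K f φ z) φ (m + 1) =
    hirotaTau n (fun k => Delta K (φ k)) (fun k => DeltaStar K (φ k))
      (fun k => f k * (DeltaStar K (φ k) / Delta K (φ k)) *
        Complex.exp (2 * Complex.I * φ k) ^ m *
        (vertex (Delta K (φ k)) (DeltaStar K (φ k)) z *
          vertex (Delta K (φ k)) (DeltaStar K (φ k)) 0)) := by
  rw [shiftTau_eq_base]
  congr 1
  funext k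
  rw [pow_succ, ← Delta_div_DeltaStar hK, vertex_zero]
  ring

theorem Theta_eq_shiftTau (m : ℕ) : Theta K n f φ m = tau K n (shiftAmp K f φ 1) φ m := by
  rw [Theta]
  congr 1
  funext k
  rw [cFun_eq, shiftAmp]
  ring

theorem shiftTheta_succ_eq_base (hK : K ≠ 0) (z : ℂ) (m : ℕ) :
    Theta K n (shiftAmp K f φ z) φ (m + 1) =
    hirotaTau n (fun k => Delta K (φ k)) (fun k => DeltaStar K (φ k))
      (fun k => f k * (DeltaStar K (φ k) / Delta K (φ k)) *
        Complex.exp (2 * Complex.I * φ k) ^ m *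
        (vertex (Delta K (φ k)) (DeltaStar K (φ k)) z *
          vertex (Delta K (φ k)) (DeltaStar K (φ k)) 1)) := by
  rw [Theta_eq_shiftTau, shiftTau_succ_eq_base hK]
  congr 1
  funext k
  have := Delta_ne_zero hK (φ k)
  have := DeltaStar_ne_zero hK (φ k)
  rw [vertex_zero, shiftAmp]
  field_simp

theorem Delta_avoids (h : Generic M K) (k : Fin n) :
    (0 ≠ Delta K (φ k) ∧ 0 ≠ DeltaStar K (φ k)) ∧ (1 ≠ Delta K (φ k) ∧ 1 ≠ DeltaStar K (φ k)) ∧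
      (-K ≠ Delta K (φ k) ∧ -K ≠ DeltaStar K (φ k)) :=
  ⟨⟨(Delta_ne_zero h.ne_zero _).symm, (DeltaStar_ne_zero h.ne_zero _).symm⟩,
    ⟨(Delta_ne_one h.one_add _).symm, (DeltaStar_ne_one h.one_add _).symm⟩,
    ⟨(ne_neg_of_curve h.one_add (Delta_curve K _) (DeltaStar_ne_zero h.ne_zero _)).symm,
    (ne_neg_of_curve h.one_add ((mul_comm _ _).trans (Delta_curve K _))
      (Delta_ne_zero h.ne_zero _)).symm⟩⟩

/-- Shifted tau-functions solve the linear problem. -/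
theorem linSol_shift (h : Generic M K) (hφ : ∀ k, φ k ∈ allowedPhases M)
    (hinj : Function.Injective φ) {z w : ℂ} (hw0 : w ≠ 0) (hzw : (z - 1) * (w - 1) = 1 + K)
    (hz : ∀ k, z ≠ DeltaStar K (φ k)) :
    LinSol K (z * w) (tau K n f φ) (Theta K n f φ)
      (fun m => w⁻¹ ^ m * tau K n (shiftAmp K f φ z) φ m)
      (fun m => w * (z - 1) * (w⁻¹ ^ m * Theta K n (shiftAmp K f φ z) φ m)) := by
  have hpq := distinctPoles h hφ hinj
  have hK := h.ne_zero
  intro i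
  -- The points 0 and -K are conjugate on the curve: (0 - 1)(-K - 1) = 1 + K.
  have hconj : ∀ k, vertex (Delta K (φ k)) (DeltaStar K (φ k)) 0 *
      vertex (Delta K (φ k)) (DeltaStar K (φ k)) (-K) =
      vertex (Delta K (φ k)) (DeltaStar K (φ k)) 1 := fun k =>
    vertex_mul_conj h.one_add (Delta_curve K _) (by ring) (Delta_avoids h k).1.2
      (Delta_avoids h k).2.2.2
  constructor
  -- The first equation is the three-term relation at the points z, 0, 1.
  · have key := hirota_three_term' (fun k => f k * (DeltaStar K (φ k) / Delta K (φ k)) *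
        Complex.exp (2 * Complex.I * φ k) ^ i) hpq hz (fun k => (Delta_avoids h k).1)
        (fun k => (Delta_avoids h k).2.1)
    rw [← shiftTau_eq_base z, ← tau_eq_base hK, ← shiftTau_eq_base 1,
      ← shiftTheta_succ_eq_base hK z, ← shiftTau_succ_eq_base hK z] at key
    simp only [mul_comm (vertex _ _ 0) (vertex _ _ 1)] at key
    rw [← shiftTau_succ_eq_base hK, ← Theta_eq_shiftTau, ← Theta_eq_shiftTau] at key
    simp only [pow_succ]
    field_simp
    linear_combination key
  -- The second equation is the relation at z, 0, -K, with one factor at 0 put into the amplitude in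
  -- advance. Each factor at -K then pairs with it to give a factor at 1.
  · have key := hirota_three_term' (fun k => f k * (DeltaStar K (φ k) / Delta K (φ k)) *
        Complex.exp (2 * Complex.I * φ k) ^ i * vertex (Delta K (φ k)) (DeltaStar K (φ k)) 0)
        hpq hz (fun k => (Delta_avoids h k).1) (fun k => (Delta_avoids h k).2.2)
    have e1 : ∀ x : ℂ, (fun k => f k * (DeltaStar K (φ k) / Delta K (φ k)) *
        Complex.exp (2 * Complex.I * φ k) ^ i * vertex (Delta K (φ k)) (DeltaStar K (φ k)) 0 *
        vertex (Delta K (φ k)) (DeltaStar K (φ k)) x) =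
        (fun k => f k * (DeltaStar K (φ k) / Delta K (φ k)) *
        Complex.exp (2 * Complex.I * φ k) ^ i * (vertex (Delta K (φ k)) (DeltaStar K (φ k)) x *
        vertex (Delta K (φ k)) (DeltaStar K (φ k)) 0)) := fun x => funext fun k => by ring
    have e2 : (fun k => f k * (DeltaStar K (φ k) / Delta K (φ k)) *
        Complex.exp (2 * Complex.I * φ k) ^ i * vertex (Delta K (φ k)) (DeltaStar K (φ k)) 0 *
        (vertex (Delta K (φ k)) (DeltaStar K (φ k)) z *
          vertex (Delta K (φ k)) (DeltaStar K (φ k)) (-K))) =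
        (fun k => f k * (DeltaStar K (φ k) / Delta K (φ k)) *
        Complex.exp (2 * Complex.I * φ k) ^ i * (vertex (Delta K (φ k)) (DeltaStar K (φ k)) z *
        vertex (Delta K (φ k)) (DeltaStar K (φ k)) 1)) := funext fun k => by
      rw [← hconj]; ring
    have e3 : (fun k => f k * (DeltaStar K (φ k) / Delta K (φ k)) *
        Complex.exp (2 * Complex.I * φ k) ^ i * (vertex (Delta K (φ k)) (DeltaStar K (φ k)) (-K) *
        vertex (Delta K (φ k)) (DeltaStar K (φ k)) 0)) =
        (fun k => f k * (DeltaStar K (φ k) / Delta K (φ k)) *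
        Complex.exp (2 * Complex.I * φ k) ^ i *
        vertex (Delta K (φ k)) (DeltaStar K (φ k)) 1) := funext fun k => by
      rw [← hconj]; ring
    have e4 : (fun k => f k * (DeltaStar K (φ k) / Delta K (φ k)) *
        Complex.exp (2 * Complex.I * φ k) ^ i * vertex (Delta K (φ k)) (DeltaStar K (φ k)) 0 *
        (vertex (Delta K (φ k)) (DeltaStar K (φ k)) 0 *
          vertex (Delta K (φ k)) (DeltaStar K (φ k)) (-K))) =
        (fun k => f k * (DeltaStar K (φ k) / Delta K (φ k)) *
        Complex.exp (2 * Complex.I * φ k) ^ i * (vertex (Delta K (φ k)) (DeltaStar K (φ k)) 1 *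
        vertex (Delta K (φ k)) (DeltaStar K (φ k)) 0)) := funext fun k => by
      rw [← hconj]; ring
    have e5 : (fun k => f k * (DeltaStar K (φ k) / Delta K (φ k)) *
        Complex.exp (2 * Complex.I * φ k) ^ i * vertex (Delta K (φ k)) (DeltaStar K (φ k)) 0 *
        (vertex (Delta K (φ k)) (DeltaStar K (φ k)) z *
          vertex (Delta K (φ k)) (DeltaStar K (φ k)) 0)) =
        (fun k => f k * (DeltaStar K (φ k) / Delta K (φ k)) *
        Complex.exp (2 * Complex.I * φ k) ^ (i + 1) *
          (vertex (Delta K (φ k)) (DeltaStar K (φ k)) z *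
        vertex (Delta K (φ k)) (DeltaStar K (φ k)) 0)) := funext fun k => by
      rw [pow_succ, ← Delta_div_DeltaStar hK, vertex_zero]; ring
    rw [e1 z, e1 0, e1 (-K), e2, e3, e4, e5, ← shiftTau_succ_eq_base hK z i,
      ← shiftTau_succ_eq_base hK 1 i, ← shiftTau_succ_eq_base hK z (i + 1), ← tau_succ_eq_base hK, ← shiftTau_eq_base 1 i,
      ← shiftTheta_succ_eq_base hK, ← Theta_eq_shiftTau, ← Theta_eq_shiftTau] at key
    simp only [pow_succ]
    field_simp
    linear_combination key -
      tau K n f φ (i + 1) * Theta K n (shiftAmp K f φ z) φ (i + 1) * hzw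

/-- The Casoratian of the two solutions of the linear problem. -/
theorem casoratian_shift (h : Generic M K) (hφ : ∀ k, φ k ∈ allowedPhases M)
    (hinj : Function.Injective φ) {z w : ℂ} (hzw : (z - 1) * (w - 1) = 1 + K)
    (hz : ∀ k, z ≠ DeltaStar K (φ k)) (hw : ∀ k, w ≠ DeltaStar K (φ k)) (m : ℕ) :
    z * tau K n (shiftAmp K f φ z) φ (m + 1) * tau K n (shiftAmp K f φ w) φ m -
      w * tau K n (shiftAmp K f φ z) φ m * tau K n (shiftAmp K f φ w) φ (m + 1) =
      (z - w) * (tau K n f φ m * Theta K n f φ m) := by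
  have hpq := distinctPoles h hφ hinj
  have hK := h.ne_zero
  have hwp : ∀ k, w ≠ Delta K (φ k) := fun k h0 => hz k
    (curve_unique h.one_add ((mul_comm _ _).trans hzw) (Delta_curve K _) h0)
  -- Three-term relation at z, w, 0. The factors at the conjugate points z, w combine to the factor
  -- at 1, which is why T Θ appears.
  have key := hirota_three_term' (fun k => f k * (DeltaStar K (φ k) / Delta K (φ k)) *
      Complex.exp (2 * Complex.I * φ k) ^ m) hpq hz (fun k => ⟨hwp k, hw k⟩)
      (fun k => (Delta_avoids h k).1)
  have hconj : ∀ k, vertex (Delta K (φ k)) (DeltaStar K (φ k)) z *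
      vertex (Delta K (φ k)) (DeltaStar K (φ k)) w =
      vertex (Delta K (φ k)) (DeltaStar K (φ k)) 1 := fun k =>
    vertex_mul_conj h.one_add (Delta_curve K _) hzw (hz k) (hw k)
  simp only [hconj] at key
  rw [← shiftTau_succ_eq_base hK w, ← shiftTau_succ_eq_base hK z, ← shiftTau_eq_base z,
    ← shiftTau_eq_base w, ← shiftTau_eq_base 1, ← Theta_eq_shiftTau, ← tau_eq_base hK] at key
  linear_combination -key

end Tau

/-! ### The three-term recurrence -/

/-- The three-term recurrence obtained from the linear problem by eliminating `R`. -/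
def TauRec (K L : ℂ) (T Θ P : ℕ → ℂ) : Prop :=
  ∀ i, L * T i * Θ i * P (i + 2) =
    P (i + 1) * (L * T (i + 1) * Θ i - K * T i * Θ (i + 1)) - P i * T (i + 1) * Θ (i + 1)

section Recurrence

variable {K L : ℂ} {T Θ : ℕ → ℂ}

theorem LinSol.tauRec {P R : ℕ → ℂ} (h : LinSol K L T Θ P R) : TauRec K L T Θ P := fun i => by
  linear_combination T i * (h i).2 - T (i + 1) * (h i).1

theorem LinSol.add {P R P' R' : ℕ → ℂ} (h : LinSol K L T Θ P R) (h' : LinSol K L T Θ P' R')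
    (c : ℂ) : LinSol K L T Θ (fun m => P m + c * P' m) (fun m => R m + c * R' m) := fun i => by
  constructor
  · linear_combination (h i).1 + c * (h' i).1
  · linear_combination (h i).2 + c * (h' i).2

theorem TauRec.const_mul {P : ℕ → ℂ} (h : TauRec K L T Θ P) (c : ℂ) :
    TauRec K L T Θ (fun m => c * P m) := fun i => by
  linear_combination c * h i

/-- A pair of equations with nonvanishing determinant has only the trivial solution. -/
theorem eq_zero_of_det_ne_zero {a b c d x y : ℂ} (hdet : a * d - c * b ≠ 0)
    (h1 : x * a + y * b = 0) (h2 : x * c + y * d = 0) : x = 0 ∧ y = 0 := by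
  constructor
  · apply (mul_eq_zero.1 (?_ : (a * d - c * b) * x = 0)).resolve_left hdet
    linear_combination d * h1 - b * h2
  · apply (mul_eq_zero.1 (?_ : (a * d - c * b) * y = 0)).resolve_left hdet
    linear_combination a * h2 - c * h1

/-- The leading coefficient L T Θ never vanishes, so two initial values propagate. -/
theorem TauRec.ext {P Q : ℕ → ℂ} (hL : L ≠ 0) (hT : ∀ i, T i ≠ 0) (hΘ : ∀ i, Θ i ≠ 0)
    (hP : TauRec K L T Θ P) (hQ : TauRec K L T Θ Q) (h0 : P 0 = Q 0) (h1 : P 1 = Q 1) :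
    ∀ m, P m = Q m := by
  have : ∀ m, P m = Q m ∧ P (m + 1) = Q (m + 1) := by
    intro m
    induction m with
    | zero => exact ⟨h0, h1⟩
    | succ m ih =>
      refine ⟨ih.2, mul_left_cancel₀ (mul_ne_zero (mul_ne_zero hL (hT m)) (hΘ m)) ?_⟩
      rw [hP m, hQ m, ih.1, ih.2]
  exact fun m => (this m).1

/-- Two independent solutions span the space of solutions. -/
theorem TauRec.span {P P₁ P₂ : ℕ → ℂ} (hL : L ≠ 0) (hT : ∀ i, T i ≠ 0) (hΘ : ∀ i, Θ i ≠ 0)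
    (hP : TauRec K L T Θ P) (h₁ : TauRec K L T Θ P₁) (h₂ : TauRec K L T Θ P₂)
    (hdet : P₁ 0 * P₂ 1 - P₁ 1 * P₂ 0 ≠ 0) : ∃ A B : ℂ, ∀ m, P m = A * P₁ m + B * P₂ m := by
  refine ⟨(P 0 * P₂ 1 - P 1 * P₂ 0) / (P₁ 0 * P₂ 1 - P₁ 1 * P₂ 0),
    (P₁ 0 * P 1 - P₁ 1 * P 0) / (P₁ 0 * P₂ 1 - P₁ 1 * P₂ 0), ?_⟩
  refine TauRec.ext hL hT hΘ hP (fun i => ?_) ?_ ?_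
  · linear_combination (P 0 * P₂ 1 - P 1 * P₂ 0) / (P₁ 0 * P₂ 1 - P₁ 1 * P₂ 0) * h₁ i +
      (P₁ 0 * P 1 - P₁ 1 * P 0) / (P₁ 0 * P₂ 1 - P₁ 1 * P₂ 0) * h₂ i
  · rw [div_mul_eq_mul_div, div_mul_eq_mul_div, ← add_div, eq_div_iff hdet]; ring
  · rw [div_mul_eq_mul_div, div_mul_eq_mul_div, ← add_div, eq_div_iff hdet]; ring

/-- If the multipliers of two independent solutions are distinct, a quasi-periodic solution is a
multiple of one of them. -/
theorem TauRec.of_ne_multiplier {P P₁ P₂ : ℕ → ℂ} {M : ℕ} {μ μ₁ μ₂ : ℂ} (hL : L ≠ 0)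
    (hT : ∀ i, T i ≠ 0) (hΘ : ∀ i, Θ i ≠ 0) (hP : TauRec K L T Θ P) (h₁ : TauRec K L T Θ P₁)
    (h₂ : TauRec K L T Θ P₂) (hdet : P₁ 0 * P₂ 1 - P₁ 1 * P₂ 0 ≠ 0)
    (hper : ∀ i, P (i + M) = μ * P i) (hper₁ : ∀ i, P₁ (i + M) = μ₁ * P₁ i)
    (hper₂ : ∀ i, P₂ (i + M) = μ₂ * P₂ i) (hμ : μ₁ ≠ μ₂) :
    (∃ A : ℂ, ∀ m, P m = A * P₁ m) ∨ ∃ B : ℂ, ∀ m, P m = B * P₂ m := by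
  obtain ⟨A, B, h⟩ := TauRec.span hL hT hΘ hP h₁ h₂ hdet
  have hrel : ∀ i, A * (μ₁ - μ) * P₁ i + B * (μ₂ - μ) * P₂ i = 0 := by
    intro i
    have := hper i
    rw [h, h, hper₁, hper₂] at this
    linear_combination this
  obtain ⟨hA, hB⟩ := eq_zero_of_det_ne_zero hdet (hrel 0) (hrel 1)
  rcases mul_eq_zero.1 hA with hA | hA
  · exact Or.inr ⟨B, fun m => by rw [h, hA]; ring⟩
  · rcases mul_eq_zero.1 hB with hB | hB
    · exact Or.inl ⟨A, fun m => by rw [h, hB]; ring⟩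
    · exact absurd (by linear_combination hA - hB) hμ

/-- If the monodromy is a nontrivial Jordan block, a quasi-periodic solution is a multiple of the
quasi-periodic one. -/
theorem TauRec.of_jordan {P P₁ P₂ : ℕ → ℂ} {M : ℕ} {μ μ₁ c : ℂ} (hL : L ≠ 0)
    (hT : ∀ i, T i ≠ 0) (hΘ : ∀ i, Θ i ≠ 0) (hP : TauRec K L T Θ P) (h₁ : TauRec K L T Θ P₁)
    (h₂ : TauRec K L T Θ P₂) (hdet : P₁ 0 * P₂ 1 - P₁ 1 * P₂ 0 ≠ 0)
    (hper : ∀ i, P (i + M) = μ * P i) (hper₁ : ∀ i, P₁ (i + M) = μ₁ * P₁ i)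
    (hper₂ : ∀ i, P₂ (i + M) = μ₁ * P₂ i + c * P₁ i) (hc : c ≠ 0) :
    ∃ A : ℂ, ∀ m, P m = A * P₁ m := by
  obtain ⟨A, B, h⟩ := TauRec.span hL hT hΘ hP h₁ h₂ hdet
  have hrel : ∀ i, (A * (μ₁ - μ) + B * c) * P₁ i + B * (μ₁ - μ) * P₂ i = 0 := by
    intro i
    have := hper i
    rw [h, h, hper₁, hper₂] at this
    linear_combination this
  obtain ⟨hA, hB⟩ := eq_zero_of_det_ne_zero hdet (hrel 0) (hrel 1)
  have hB0 : B = 0 := by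
    rcases mul_eq_zero.1 hB with hB | hB
    · exact hB
    · rw [hB, mul_zero, zero_add] at hA
      exact (mul_eq_zero.1 hA).resolve_right hc
  exact ⟨A, fun m => by rw [h, hB0]; ring⟩

end Recurrence

/-- If two families of quasi-periodic solutions collide at a point, with different velocities of
the multipliers, then the quasi-periodic solution at this point is unique up to a factor. -/
theorem TauRec.of_collision {K : ℂ} {T Θ : ℕ → ℂ} {L : ℂ → ℂ} {p q : ℂ → ℕ → ℂ} {μ ν : ℂ → ℂ}
    {z₀ g μ' ν' cas' : ℂ} {cas : ℂ → ℂ} {M : ℕ}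
    (hL : L z₀ ≠ 0) (hT : ∀ i, T i ≠ 0) (hΘ : ∀ i, Θ i ≠ 0)
    (hLd : DifferentiableAt ℂ L z₀) (hpd : ∀ m, DifferentiableAt ℂ (fun z => p z m) z₀)
    (hqd : ∀ m, DifferentiableAt ℂ (fun z => q z m) z₀)
    (hp₀ : TauRec K (L z₀) T Θ (p z₀))
    (hp : ∀ᶠ z in nhdsWithin z₀ {z₀}ᶜ, TauRec K (L z) T Θ (p z))
    (hq : ∀ᶠ z in nhdsWithin z₀ {z₀}ᶜ, TauRec K (L z) T Θ (q z))
    (hpper : ∀ z m, p z (m + M) = μ z * p z m) (hqper : ∀ z m, q z (m + M) = ν z * q z m)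
    (hg : g ≠ 0) (hqp : ∀ m, q z₀ m = g * p z₀ m) (hμν : μ z₀ = ν z₀)
    (hμ : HasDerivAt μ μ' z₀) (hν : HasDerivAt ν ν' z₀) (hne : μ' ≠ ν')
    (hcas : ∀ᶠ z in nhdsWithin z₀ {z₀}ᶜ, p z 0 * q z 1 - p z 1 * q z 0 = cas z)
    (hcas₀ : cas z₀ = 0) (hcas' : HasDerivAt cas cas' z₀) (hcasne : cas' ≠ 0)
    {P : ℕ → ℂ} {lam : ℂ} (hP : TauRec K (L z₀) T Θ P) (hper : ∀ i, P (i + M) = lam * P i) :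
    ∃ A : ℂ, ∀ m, P m = A * p z₀ m := by
  -- This combination vanishes at the collision point; its derivative there is the missing second
  -- solution.
  set D : ℂ → ℕ → ℂ := fun z m => q z m - g * p z m with hD
  have hD0 : ∀ m, D z₀ m = 0 := fun m => by simp only [hD, hqp, sub_self]
  have hDd : ∀ m, DifferentiableAt ℂ (fun z => D z m) z₀ := fun m =>
    (hqd m).sub ((hpd m).const_mul g)
  set D' : ℕ → ℂ := fun m => deriv (fun z => D z m) z₀ with hD'
  have hDD : ∀ m, HasDerivAt (fun z => D z m) (D' m) z₀ := fun m => (hDd m).hasDerivAt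
  have hderiv : ∀ (e : ℂ → ℂ) (e' : ℂ), HasDerivAt e e' z₀ → e z₀ = 0 →
      (∀ᶠ z in nhdsWithin z₀ {z₀}ᶜ, e z = 0) → e' = 0 := by
    intro e e' he he0 hev
    have h1 : ∀ᶠ z in nhds z₀, e z = (fun _ => (0 : ℂ)) z := by
      rw [eventually_nhdsWithin_iff] at hev
      filter_upwards [hev] with z hz
      by_cases hz0 : z = z₀
      · rw [hz0, he0]
      · exact hz hz0
    exact he.unique ((hasDerivAt_const z₀ (0 : ℂ)).congr_of_eventuallyEq h1)
  -- Since `D z₀ = 0`, the terms with the derivative of `L` drop out.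
  have hrec : TauRec K (L z₀) T Θ D' := by
    intro i
    have hder : HasDerivAt (fun z => L z * (T i * Θ i) * D z (i + 2) -
        (D z (i + 1) * (L z * (T (i + 1) * Θ i) - K * T i * Θ (i + 1)) -
          D z i * (T (i + 1) * Θ (i + 1)))) _ z₀ :=
      ((hLd.hasDerivAt.mul_const (T i * Θ i)).mul (hDD (i + 2))).sub
        (((hDD (i + 1)).mul ((hLd.hasDerivAt.mul_const (T (i + 1) * Θ i)).sub_const
          (K * T i * Θ (i + 1)))).sub ((hDD i).mul_const (T (i + 1) * Θ (i + 1))))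
    have := hderiv _ _ hder (by simp only [hD0]; ring) (by
      filter_upwards [hp, hq] with z h1 h2
      linear_combination h2 i - g * h1 i)
    simp only [hD0] at this
    linear_combination this
  -- The difference of the velocities of the multipliers is the off-diagonal entry of a Jordan
  -- block.
  have hDper : ∀ m, D' (m + M) = μ z₀ * D' m + g * (ν' - μ') * p z₀ m := by
    intro m
    have hder : HasDerivAt (fun z => D z (m + M) - (ν z * D z m + g * ((ν z - μ z) * p z m))) _
        z₀ := (hDD (m + M)).sub ((hν.mul (hDD m)).add
          (((hν.sub hμ).mul (hpd m).hasDerivAt).const_mul g))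
    have := hderiv _ _ hder (by simp only [hD0, hμν]; ring)
      (Filter.Eventually.of_forall fun z => by simp only [hD, hpper, hqper]; ring)
    simp only [hD0, hμν, Pi.sub_apply] at this
    rw [hμν]
    linear_combination this
  -- `D'` is independent of `p z₀` because the Casoratian vanishes only to first order.
  have hdet : p z₀ 0 * D' 1 - p z₀ 1 * D' 0 = cas' := by
    have hder : HasDerivAt (fun z => p z 0 * D z 1 - p z 1 * D z 0 - cas z) _ z₀ :=
      (((hpd 0).hasDerivAt.mul (hDD 1)).sub ((hpd 1).hasDerivAt.mul (hDD 0))).sub hcas'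
    have := hderiv _ _ hder (by simp only [hD0, hcas₀]; ring) (by
      filter_upwards [hcas] with z h1
      rw [← h1]
      simp only [hD]
      ring)
    simp only [hD0] at this
    linear_combination this
  exact TauRec.of_jordan hL hT hΘ hP hp₀ hrec (by rwa [hdet]) hper (hpper z₀) hDper
    (mul_ne_zero hg (sub_ne_zero.2 hne.symm))

/-! ### Colliding solutions -/

/-- The involution `Δ ↦ Δ*` of the curve. -/
def conjPoint (K z : ℂ) : ℂ := (z + K) / (z - 1)

theorem conjPoint_curve {K z : ℂ} (hz : z ≠ 1) : (z - 1) * (conjPoint K z - 1) = 1 + K := by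
  have := sub_ne_zero.2 hz
  rw [conjPoint]
  field_simp
  ring

theorem conjPoint_eq {K z w : ℂ} (hK1 : 1 + K ≠ 0) (hzw : (z - 1) * (w - 1) = 1 + K) :
    conjPoint K z = w := by
  have hz : z ≠ 1 := by
    rintro rfl
    exact hK1 (by rw [← hzw]; ring)
  exact curve_unique hK1 (conjPoint_curve hz) hzw rfl

theorem conjPoint_hasDerivAt {K z w : ℂ} (hK1 : 1 + K ≠ 0) (hzw : (z - 1) * (w - 1) = 1 + K) :
    HasDerivAt (conjPoint K) (-((w - 1) / (z - 1))) z := by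
  have hz : z - 1 ≠ 0 := by
    intro h
    exact hK1 (by rw [← hzw, h, zero_mul])
  have h := ((hasDerivAt_id z).add_const K).div ((hasDerivAt_id z).sub_const 1) hz
  refine h.congr_deriv ?_
  simp only [id]
  field_simp
  linear_combination hzw

theorem hasDerivAt_inv_pow {h : ℂ → ℂ} {h' z : ℂ} {M : ℕ} (hM : 0 < M) (hh : HasDerivAt h h' z)
    (h0 : h z ≠ 0) :
    HasDerivAt (fun x => (h x)⁻¹ ^ M) (-(M * (h z)⁻¹ ^ M * h' / h z)) z := by
  obtain ⟨k, rfl⟩ : ∃ k, M = k + 1 := ⟨M - 1, by omega⟩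
  refine ((hh.inv h0).pow (k + 1)).congr_deriv ?_
  simp only [Pi.inv_apply, add_tsub_cancel_right, pow_succ, inv_pow]
  field_simp

/-- These are the derivatives along the curve of w^(-M) and z^(-M), where dw/dz = -(w - 1)/(z - 1).
When the two powers agree, equal derivatives mean 2zw = z + w, which on the curve is zw + K = 0. -/
theorem multiplier_deriv_ne {K z w : ℂ} {M : ℕ} (hM : 0 < M) (hK1 : 1 + K ≠ 0) (hz : z ≠ 0)
    (hw : w ≠ 0) (hzw : (z - 1) * (w - 1) = 1 + K) (hne : z * w + K ≠ 0)
    (hμ : w⁻¹ ^ M = z⁻¹ ^ M) :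
    -((M : ℂ) * w⁻¹ ^ M * -((w - 1) / (z - 1)) / w) ≠ -(M * z⁻¹ ^ M * 1 / z) := by
  have hM' : (M : ℂ) ≠ 0 := by exact_mod_cast hM.ne'
  have hz1 : z - 1 ≠ 0 := by
    intro h
    exact hK1 (by rw [← hzw, h, zero_mul])
  have hpow : z⁻¹ ^ M ≠ 0 := pow_ne_zero _ (inv_ne_zero hz)
  rw [hμ]
  generalize z⁻¹ ^ M = c at hpow ⊢
  intro h
  field_simp at h
  apply hne
  linear_combination h - hzw

theorem tau_differentiableAt (K : ℂ) {n : ℕ} {f : ℂ → Fin n → ℂ} (φ : Fin n → ℂ) {z : ℂ}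
    (hf : ∀ k, DifferentiableAt ℂ (fun x => f x k) z) (m : ℕ) :
    DifferentiableAt ℂ (fun x => tau K n (f x) φ m) z := by
  simp only [tau_eq_hirotaTau]
  exact hirotaTau_differentiableAt _ _ _ _ fun k => (hf k).mul_const _

theorem shiftAmp_differentiableAt (K : ℂ) {n : ℕ} (f φ : Fin n → ℂ) {h : ℂ → ℂ} {z : ℂ}
    (hh : DifferentiableAt ℂ h z) (k : Fin n) (hk : h z ≠ DeltaStar K (φ k)) :
    DifferentiableAt ℂ (fun x => shiftAmp K f φ (h x) k) z := by
  simp only [shiftAmp]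
  exact (((vertex_differentiableAt hk).comp z hh).const_mul _).const_mul _

/-- Near any point of the curve, all points but this one are generic. -/
theorem eventually_generic {M : ℕ} {K : ℂ} {n : ℕ} (φ : Fin n → ℂ) (h : Generic M K) {z₀ w₀ : ℂ}
    (hz₀ : z₀ ≠ 0) (hw₀ : w₀ ≠ 0) (hzw : (z₀ - 1) * (w₀ - 1) = 1 + K) :
    ∀ᶠ z in nhdsWithin z₀ {z₀}ᶜ, z ≠ 0 ∧ conjPoint K z ≠ 0 ∧
      (z - 1) * (conjPoint K z - 1) = 1 + K ∧ (∀ k, z ≠ DeltaStar K (φ k)) ∧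
      (∀ k, conjPoint K z ≠ DeltaStar K (φ k)) := by
  have hz1 : z₀ ≠ 1 := by
    rintro rfl
    exact h.one_add (by rw [← hzw]; ring)
  have hzK : z₀ ≠ -K := ne_neg_of_curve h.one_add hzw hw₀
  filter_upwards [nhdsWithin_le_nhds (isOpen_ne.mem_nhds hz₀),
    nhdsWithin_le_nhds (isOpen_ne.mem_nhds hz1), nhdsWithin_le_nhds (isOpen_ne.mem_nhds hzK),
    eventually_avoids (fun k => Delta K (φ k)) z₀, eventually_avoids (fun k => DeltaStar K (φ k)) z₀]
    with z h0 h1 hK hp hq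
  have hc := conjPoint_curve (K := K) h1
  refine ⟨h0, ?_, hc, hq, fun k hk => hp k ?_⟩
  · rw [conjPoint]
    refine div_ne_zero (fun h' => hK ?_) (sub_ne_zero.2 h1)
    exact eq_neg_of_add_eq_zero_left h'
  · exact curve_unique h.one_add ((mul_comm _ _).trans hc)
      ((mul_comm _ _).trans (Delta_curve K _)) hk

/-- The Casoratian with the exponential prefactors included. The factor w - z shows that the two
solutions are independent away from the branch points when T and Θ do not vanish. -/
theorem casoratian_inv_pow {M : ℕ} {K : ℂ} {n : ℕ} {f φ : Fin n → ℂ} (h : Generic M K)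
    (hφ : ∀ k, φ k ∈ allowedPhases M) (hinj : Function.Injective φ) {z w : ℂ}
    (hzw : (z - 1) * (w - 1) = 1 + K) (hz0 : z ≠ 0) (hw0 : w ≠ 0)
    (hz : ∀ k, z ≠ DeltaStar K (φ k)) (hw : ∀ k, w ≠ DeltaStar K (φ k)) :
    w⁻¹ ^ 0 * tau K n (shiftAmp K f φ z) φ 0 * (z⁻¹ ^ 1 * tau K n (shiftAmp K f φ w) φ 1) -
      w⁻¹ ^ 1 * tau K n (shiftAmp K f φ z) φ 1 * (z⁻¹ ^ 0 * tau K n (shiftAmp K f φ w) φ 0) =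
      (w - z) * (tau K n f φ 0 * Theta K n f φ 0 / (z * w)) := by
  have h1 := casoratian_shift (f := f) h hφ hinj hzw hz hw 0
  rw [zero_add] at h1
  field_simp
  linear_combination -h1

section Collision

variable {M : ℕ} {K : ℂ}

/-- At a branch point of the curve, the quasi-periodic solution is unique. -/
theorem unique_at_branch_point {n : ℕ} {f φ : Fin n → ℂ} (h : Generic M K)
    (hφ : ∀ k, φ k ∈ allowedPhases M) (hinj : Function.Injective φ)
    (hT : ∀ m, tau K n f φ m ≠ 0) (hΘ : ∀ m, Theta K n f φ m ≠ 0) {z₀ : ℂ} (hz₀ : z₀ ≠ 0)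
    (hzz : (z₀ - 1) * (z₀ - 1) = 1 + K) (hne : z₀ * z₀ + K ≠ 0)
    (hq : ∀ k, z₀ ≠ DeltaStar K (φ k)) {P : ℕ → ℂ} {μ : ℂ}
    (hP : TauRec K (z₀ * z₀) (tau K n f φ) (Theta K n f φ) P) (hper : ∀ i, P (i + M) = μ * P i) :
    ∃ A : ℂ, ∀ m, P m = A * (z₀⁻¹ ^ m * tau K n (shiftAmp K f φ z₀) φ m) := by
  have hc0 : conjPoint K z₀ = z₀ := conjPoint_eq h.one_add hzz
  have hcd := conjPoint_hasDerivAt h.one_add hzz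
  have hz1 : z₀ - 1 ≠ 0 := by
    intro h0
    exact h.one_add (by rw [← hzz, h0, zero_mul])
  have hev := eventually_generic φ h hz₀ hz₀ hzz
  have hdc : DifferentiableAt ℂ (fun z => (conjPoint K z)⁻¹) z₀ :=
    hcd.differentiableAt.inv (by rwa [hc0])
  have hμ := hasDerivAt_inv_pow h.pos hcd (by rwa [hc0])
  have hν := hasDerivAt_inv_pow h.pos (hasDerivAt_id z₀) hz₀
  have hcas : HasDerivAt (fun z => (conjPoint K z - z) *
      (tau K n f φ 0 * Theta K n f φ 0 / (z * conjPoint K z))) _ z₀ :=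
    (hcd.sub (hasDerivAt_id z₀)).mul (DifferentiableAt.hasDerivAt
      ((differentiableAt_const _).div (differentiableAt_id.mul hcd.differentiableAt)
        (by simp only [hc0]; exact mul_ne_zero hz₀ hz₀)))
  -- The families are the two orders of (z, w). They coincide at z₀ = w₀, so `g = 1`. The
  -- conjugation has derivative -1 there, so w - z has derivative -2.
  have key := TauRec.of_collision (K := K) (T := tau K n f φ) (Θ := Theta K n f φ)
    (L := fun z => z * conjPoint K z)
    (p := fun z m => (conjPoint K z)⁻¹ ^ m * tau K n (shiftAmp K f φ z) φ m)
    (q := fun z m => z⁻¹ ^ m * tau K n (shiftAmp K f φ (conjPoint K z)) φ m)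
    (μ := fun z => (conjPoint K z)⁻¹ ^ M) (ν := fun z => z⁻¹ ^ M)
    (z₀ := z₀) (g := 1) (M := M) (P := P) (lam := μ)
    (cas := fun z => (conjPoint K z - z) *
      (tau K n f φ 0 * Theta K n f φ 0 / (z * conjPoint K z)))
    (by rw [hc0]; exact mul_ne_zero hz₀ hz₀) hT hΘ
    (differentiableAt_id.mul hcd.differentiableAt)
    (fun m => (hdc.pow m).mul (tau_differentiableAt K φ
      (fun k => shiftAmp_differentiableAt K f φ differentiableAt_id k (hq k)) m))
    (fun m => ((differentiableAt_inv hz₀).pow m).mul (tau_differentiableAt K φ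
      (fun k => shiftAmp_differentiableAt K f φ hcd.differentiableAt k (by rw [hc0]; exact hq k))
      m))
    (by rw [hc0]; exact (linSol_shift h hφ hinj hz₀ hzz hq).tauRec)
    (hev.mono fun z hz => (linSol_shift h hφ hinj hz.2.1 hz.2.2.1 hz.2.2.2.1).tauRec)
    (hev.mono fun z hz => by
      have := (linSol_shift (f := f) h hφ hinj hz.1 ((mul_comm _ _).trans hz.2.2.1)
        hz.2.2.2.2).tauRec
      rwa [mul_comm] at this)
    (fun z m => by rw [tau_add_period h.pos hφ]; ring)
    (fun z m => by rw [tau_add_period h.pos hφ]; ring)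
    one_ne_zero (fun m => by rw [hc0, one_mul]) (by rw [hc0]) hμ hν
    (by rw [hc0]; exact multiplier_deriv_ne h.pos h.one_add hz₀ hz₀ hzz hne rfl)
    (hev.mono fun z hz =>
      casoratian_inv_pow h hφ hinj hz.2.2.1 hz.1 hz.2.1 hz.2.2.2.1 hz.2.2.2.2)
    (by rw [hc0]; ring) hcas
    (by
      rw [hc0, div_self hz1]
      simp only [Pi.sub_apply, id, hc0, sub_self, zero_mul, add_zero]
      exact mul_ne_zero (by norm_num) (div_ne_zero (mul_ne_zero (hT 0) (hΘ 0))
        (mul_ne_zero hz₀ hz₀)))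
    (by rwa [hc0]) hper
  simpa only [hc0] using key

theorem tau_eq_of_zero {n : ℕ} (f φ : Fin (n + 1) → ℂ) {j : Fin (n + 1)} (hj : f j = 0) (m : ℕ) :
    tau K (n + 1) f φ m =
      tau K n (fun k => f (j.succAbove k)) (fun k => φ (j.succAbove k)) m := by
  rw [tau_succAbove K f φ m j, hj]
  ring

theorem Theta_eq_of_zero {n : ℕ} (f φ : Fin (n + 1) → ℂ) {j : Fin (n + 1)} (hj : f j = 0)
    (m : ℕ) : Theta K (n + 1) f φ m =
      Theta K n (fun k => f (j.succAbove k)) (fun k => φ (j.succAbove k)) m :=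
  tau_eq_of_zero _ φ (by rw [hj, mul_zero]) m

/-- The vertex factor of soliton `j` vanishes at its own pole Δ(φ_j). This is the mechanism of
annihilation. -/
theorem shiftAmp_self {n : ℕ} (f φ : Fin n → ℂ) (j : Fin n) :
    shiftAmp K f φ (Delta K (φ j)) j = 0 := by
  simp [shiftAmp, vertex]

/-- The tau-function with shift `w`, multiplied by `w - Δ*(φ_j)`. -/
def residueTau (K : ℂ) {n : ℕ} (f φ : Fin (n + 1) → ℂ) (j : Fin (n + 1)) (w : ℂ) (m : ℕ) : ℂ :=
  (w - DeltaStar K (φ j)) * tau K n (fun k => shiftAmp K f φ w (j.succAbove k))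
      (fun k => φ (j.succAbove k)) m +
    f j * (DeltaStar K (φ j) / Delta K (φ j) * (w - Delta K (φ j))) *
      Complex.exp (2 * Complex.I * φ j) ^ m *
      tau K n (fun k => phaseShift K (φ (j.succAbove k)) (φ j) *
        shiftAmp K f φ w (j.succAbove k)) (fun k => φ (j.succAbove k)) m

/-- Only the amplitude of soliton `j` has the pole Δ*(φ_j), and it enters linearly. `residueTau`
therefore continues the rescaled solution to that point. -/
theorem residueTau_eq {n : ℕ} (f φ : Fin (n + 1) → ℂ) (j : Fin (n + 1)) {w : ℂ}
    (hw : w ≠ DeltaStar K (φ j)) (m : ℕ) :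
    residueTau K f φ j w m =
      (w - DeltaStar K (φ j)) * tau K (n + 1) (shiftAmp K f φ w) φ m := by
  have := sub_ne_zero.2 hw
  have hs : shiftAmp K f φ w j = f j * (DeltaStar K (φ j) / Delta K (φ j) *
    ((w - Delta K (φ j)) / (w - DeltaStar K (φ j)))) := rfl
  rw [residueTau, tau_succAbove K _ φ m j, hs]
  field_simp

/-- At the spectral parameter of a soliton of the chain, the quasi-periodic solution is unique. -/
theorem unique_at_soliton {n : ℕ} {f φ : Fin (n + 1) → ℂ} (h : Generic M K)
    (hφ : ∀ k, φ k ∈ allowedPhases M) (hinj : Function.Injective φ)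
    (hT : ∀ m, tau K (n + 1) f φ m ≠ 0) (hΘ : ∀ m, Theta K (n + 1) f φ m ≠ 0) (j : Fin (n + 1))
    (hfj : f j ≠ 0) {P : ℕ → ℂ} {μ : ℂ}
    (hP : TauRec K (Delta K (φ j) * DeltaStar K (φ j)) (tau K (n + 1) f φ)
      (Theta K (n + 1) f φ) P) (hper : ∀ i, P (i + M) = μ * P i) :
    ∃ A : ℂ, ∀ m, P m = A * ((DeltaStar K (φ j))⁻¹ ^ m *
      tau K (n + 1) (shiftAmp K f φ (Delta K (φ j))) φ m) := by
  have hpq := distinctPoles h hφ hinj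
  have hexp := Delta_div_DeltaStar h.ne_zero (φ j)
  have hexpM := exp_allowed h.pos (hφ j)
  have hzw := Delta_curve K (φ j)
  have hz₀ := Delta_ne_zero h.ne_zero (φ j)
  have hw₀ := DeltaStar_ne_zero h.ne_zero (φ j)
  have hne : Delta K (φ j) * DeltaStar K (φ j) + K ≠ 0 :=
    Lam_add_ne_zero h.ne_zero (h.allowed (hφ j))
  have hq : ∀ k, Delta K (φ j) ≠ DeltaStar K (φ k) := fun k => hpq.ne j k
  have hqq : ∀ k, DeltaStar K (φ j) ≠ DeltaStar K (φ (j.succAbove k)) := fun k h0 =>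
    (j.succAbove_ne k).symm (hpq.right h0)
  have hqp : ∀ k, DeltaStar K (φ j) ≠ Delta K (φ (j.succAbove k)) := fun k => (hpq.ne _ _).symm
  -- The residue at Δ*(φ_j) is a multiple of the other branch: the phase shift replaces the vertex
  -- factor at Δ*(φ_j) by the one at Δ(φ_j).
  have hB : ∀ m, tau K n (fun k => phaseShift K (φ (j.succAbove k)) (φ j) *
        shiftAmp K f φ (DeltaStar K (φ j)) (j.succAbove k)) (fun k => φ (j.succAbove k)) m =
      tau K (n + 1) (shiftAmp K f φ (Delta K (φ j))) φ m := by
    intro m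
    rw [tau_eq_of_zero _ φ (shiftAmp_self f φ j)]
    congr 1
    funext k
    have := vertex_ne_zero (hqp k) (hqq k)
    rw [phaseShift_eq, shiftAmp, shiftAmp]
    field_simp
  generalize hz₀' : Delta K (φ j) = z₀ at *
  generalize hw₀' : DeltaStar K (φ j) = w₀ at *
  have hc0 : conjPoint K z₀ = w₀ := conjPoint_eq h.one_add hzw
  have hcd := conjPoint_hasDerivAt h.one_add hzw
  have hz1 : z₀ - 1 ≠ 0 := by
    intro h0
    exact h.one_add (by rw [← hzw, h0, zero_mul])
  have hw1 : w₀ - 1 ≠ 0 := by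
    intro h0
    exact h.one_add (by rw [← hzw, h0, mul_zero])
  have hwz : w₀ - z₀ ≠ 0 := sub_ne_zero.2 fun h0 => hq j (by rw [hw₀', h0])
  have hev := eventually_generic φ h hz₀ hw₀ hzw
  have hdc : DifferentiableAt ℂ (fun z => (conjPoint K z)⁻¹) z₀ :=
    hcd.differentiableAt.inv (by rwa [hc0])
  have hμ := hasDerivAt_inv_pow h.pos hcd (by rwa [hc0])
  have hν := hasDerivAt_inv_pow h.pos (hasDerivAt_id z₀) hz₀
  have hcas : HasDerivAt (fun z => (conjPoint K z - w₀) * ((conjPoint K z - z) *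
      (tau K (n + 1) f φ 0 * Theta K (n + 1) f φ 0 / (z * conjPoint K z)))) _ z₀ :=
    (hcd.sub_const w₀).mul (DifferentiableAt.hasDerivAt
      ((hcd.differentiableAt.sub differentiableAt_id).mul
      ((differentiableAt_const _).div (differentiableAt_id.mul hcd.differentiableAt)
        (by simp only [hc0]; exact mul_ne_zero hz₀ hw₀))))
  -- The multipliers collide because φ_j is an allowed phase.
  have hmult : w₀⁻¹ ^ M = z₀⁻¹ ^ M := by
    have : (z₀ / w₀) ^ M = 1 := by rw [hexp, hexpM]
    rw [div_pow, div_eq_one_iff_eq (pow_ne_zero _ hw₀)] at this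
    rw [inv_pow, inv_pow, this]
  have hres : ∀ w m, residueTau K f φ j w (m + M) = residueTau K f φ j w m := by
    intro w m
    rw [residueTau, residueTau, tau_add_period h.pos fun k => hφ _,
      tau_add_period h.pos fun k => hφ _, pow_add, hexpM, mul_one]
  have hshift : ∀ k, DifferentiableAt ℂ
      (fun z => shiftAmp K f φ (conjPoint K z) (j.succAbove k)) z₀ := fun k =>
    shiftAmp_differentiableAt K f φ hcd.differentiableAt _ (by rw [hc0]; exact hqq k)
  have key := TauRec.of_collision (K := K) (T := tau K (n + 1) f φ) (Θ := Theta K (n + 1) f φ)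
    (L := fun z => z * conjPoint K z)
    (p := fun z m => (conjPoint K z)⁻¹ ^ m * tau K (n + 1) (shiftAmp K f φ z) φ m)
    (q := fun z m => z⁻¹ ^ m * residueTau K f φ j (conjPoint K z) m)
    (μ := fun z => (conjPoint K z)⁻¹ ^ M) (ν := fun z => z⁻¹ ^ M)
    -- `g` is the residue of the shifted amplitude of soliton `j`, nonzero since `f j ≠ 0`. The
    -- simple zero of the Casoratian comes from the rescaling factor w - w₀.
    (z₀ := z₀) (g := f j * (w₀ / z₀ * (w₀ - z₀))) (M := M) (P := P) (lam := μ)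
    (cas := fun z => (conjPoint K z - w₀) * ((conjPoint K z - z) *
      (tau K (n + 1) f φ 0 * Theta K (n + 1) f φ 0 / (z * conjPoint K z))))
    (by rw [hc0]; exact mul_ne_zero hz₀ hw₀) hT hΘ
    (differentiableAt_id.mul hcd.differentiableAt)
    (fun m => (hdc.pow m).mul (tau_differentiableAt K φ
      (fun k => shiftAmp_differentiableAt K f φ differentiableAt_id k (hq k)) m))
    (fun m => by
      simp only [residueTau]
      exact ((differentiableAt_inv hz₀).pow m).mul
        (((hcd.differentiableAt.sub_const _).mul (tau_differentiableAt K _ hshift m)).add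
        (((((hcd.differentiableAt.sub_const _).const_mul _).const_mul _).mul_const _).mul
          (tau_differentiableAt K _ (fun k => (hshift k).const_mul _) m))))
    (by rw [hc0]; exact (linSol_shift h hφ hinj hw₀ hzw hq).tauRec)
    (hev.mono fun z hz => (linSol_shift h hφ hinj hz.2.1 hz.2.2.1 hz.2.2.2.1).tauRec)
    (hev.mono fun z hz => by
      have := ((linSol_shift (f := f) h hφ hinj hz.1 ((mul_comm _ _).trans hz.2.2.1)
        hz.2.2.2.2).tauRec).const_mul (conjPoint K z - w₀)
      rw [mul_comm (conjPoint K z)] at this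
      convert this using 2 with m
      rw [residueTau_eq f φ j (hz.2.2.2.2 j), hw₀']
      ring)
    (fun z m => by rw [tau_add_period h.pos hφ]; ring)
    (fun z m => by rw [hres]; ring)
    (mul_ne_zero hfj (mul_ne_zero (div_ne_zero hw₀ hz₀) hwz))
    (fun m => by
      rw [hc0, residueTau, hz₀', hw₀', hB, ← hexp]
      simp only [inv_pow, div_pow]
      field_simp
      ring)
    (by rw [hc0]; exact hmult) hμ hν
    (by rw [hc0]; exact multiplier_deriv_ne h.pos h.one_add hz₀ hw₀ hzw hne hmult)
    (hev.mono fun z hz => by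
      rw [residueTau_eq f φ j (hz.2.2.2.2 j), residueTau_eq f φ j (hz.2.2.2.2 j), hw₀',
        ← casoratian_inv_pow h hφ hinj hz.2.2.1 hz.1 hz.2.1 hz.2.2.2.1 hz.2.2.2.2]
      ring)
    (by rw [hc0]; ring) hcas
    (by
      simp only [hc0, sub_self, zero_mul, add_zero]
      refine mul_ne_zero (neg_ne_zero.2 (div_ne_zero hw1 hz1)) ?_
      exact mul_ne_zero hwz (div_ne_zero (mul_ne_zero (hT 0) (hΘ 0)) (mul_ne_zero hz₀ hw₀)))
    (by rwa [hc0]) hper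
  simpa only [hc0] using key

end Collision

/-! ### Parametrization of the spectral parameter -/

theorem Lam_congr {K φ ψ : ℂ} (h : Complex.cos φ = Complex.cos ψ) : Lam K φ = Lam K ψ := by
  rw [Lam_eq, Lam_eq, radical, radical, h]

/-- With ρ² = L, the choice cos φ = (L - K)/(2ρ) makes cos² φ + K the square of (L + K)/(2ρ). If the
principal root is the negative of this, replacing φ by φ + π makes the radical -ρ, with the same
square. -/
theorem exists_Lam_eq {K L : ℂ} (hL : L ≠ 0) : ∃ φ, Lam K φ = L := by
  obtain ⟨ρ, hρ⟩ := IsAlgClosed.exists_pow_nat_eq L (n := 2) two_pos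
  have hρ0 : ρ ≠ 0 := by
    rintro rfl
    exact hL (by rw [← hρ]; simp)
  obtain ⟨φ, hφ⟩ := Complex.cos_surjective ((L - K) / (2 * ρ))
  have hs : ((Complex.cos φ ^ 2 + K) ^ (1 / 2 : ℂ)) ^ 2 = ((L + K) / (2 * ρ)) ^ 2 := by
    rw [sq_cpow_half, hφ]
    field_simp
    rw [hρ]
    ring
  rcases sq_eq_sq_iff_eq_or_eq_neg.1 hs with h | h
  · refine ⟨φ, ?_⟩
    rw [Lam_eq, radical, h, hφ, ← hρ]
    field_simp
    ring
  · refine ⟨φ + Real.pi, ?_⟩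
    rw [Lam_eq, radical, Complex.cos_add_pi, neg_sq, h, hφ, ← hρ]
    field_simp
    ring

/-- Λ depends only on cos φ. If e^(2iMφ) = 1, then φ = nπ/M. Reduction modulo 2M and the reflection
r ↦ 2M - r bring n into 0, …, M; the two endpoints lie in πℤ and the rest are allowed. -/
theorem exists_phase_of_Lam {M : ℕ} (hM : 0 < M) {K L : ℂ} (hL : L ≠ 0) :
    ∃ φ : ℂ, Lam K φ = L ∧ (φ ∈ allowedPhases M ∨
      Complex.exp (2 * Complex.I * (M : ℂ) * φ) ≠ 1 ∨ Complex.exp (2 * Complex.I * φ) = 1) := by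
  obtain ⟨φ, hφ⟩ := exists_Lam_eq (K := K) hL
  by_cases h1 : Complex.exp (2 * Complex.I * (M : ℂ) * φ) = 1
  swap
  · exact ⟨φ, hφ, Or.inr (Or.inl h1)⟩
  have hMC : (M : ℂ) ≠ 0 := by exact_mod_cast hM.ne'
  obtain ⟨n, hn⟩ := Complex.exp_eq_one_iff.1 h1
  have hφn : φ = (n : ℂ) * Real.pi / M := by
    have hI : (2 * Complex.I : ℂ) ≠ 0 := by simp
    rw [eq_div_iff hMC]
    apply mul_left_cancel₀ hI
    linear_combination hn
  have hfin : ∀ j : ℕ, j ≤ M → Complex.cos ((j : ℂ) * Real.pi / M) = Complex.cos φ →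
      ∃ φ : ℂ, Lam K φ = L ∧ (φ ∈ allowedPhases M ∨
        Complex.exp (2 * Complex.I * (M : ℂ) * φ) ≠ 1 ∨
        Complex.exp (2 * Complex.I * φ) = 1) := by
    intro j hj hcos
    refine ⟨(j : ℂ) * Real.pi / M, by rw [Lam_congr hcos, hφ], ?_⟩
    rcases Nat.eq_zero_or_pos j with h0 | h0
    · right; right
      simp [h0]
    rcases Nat.lt_or_ge j M with hlt | hge
    · exact Or.inl ⟨j, h0, hlt, rfl⟩
    · right; right
      rw [le_antisymm hj hge, mul_div_cancel_left₀ _ hMC,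
        show 2 * Complex.I * (Real.pi : ℂ) = 2 * Real.pi * Complex.I by ring]
      exact Complex.exp_two_pi_mul_I
  set r : ℤ := n % (2 * M) with hr
  have hM2 : (0 : ℤ) < 2 * M := by positivity
  have hr0 : 0 ≤ r := Int.emod_nonneg _ hM2.ne'
  have hr2 : r < 2 * M := Int.emod_lt_of_pos _ hM2
  have hcosr : Complex.cos ((r : ℂ) * Real.pi / M) = Complex.cos φ := by
    rw [Complex.cos_eq_cos_iff]
    refine ⟨n / (2 * M), Or.inl ?_⟩
    have hdiv : (n : ℂ) = 2 * M * ((n / (2 * M) : ℤ) : ℂ) + r := by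
      have := (Int.mul_ediv_add_emod n (2 * M)).symm
      rw [hr]
      exact_mod_cast this
    rw [hφn, hdiv]
    field_simp
  rcases le_or_gt r M with hle | hgt
  · obtain ⟨j, hj⟩ := Int.eq_ofNat_of_zero_le hr0
    rw [hj] at hcosr
    exact hfin j (by omega) (by exact_mod_cast hcosr)
  · obtain ⟨j, hj⟩ := Int.eq_ofNat_of_zero_le (by omega : 0 ≤ 2 * M - r)
    refine hfin j (by omega) ?_
    rw [← hcosr]
    have hjC : (j : ℂ) = 2 * M - r := by exact_mod_cast hj.symm
    rw [hjC, show (2 * (M : ℂ) - r) * Real.pi / M = 2 * Real.pi - r * Real.pi / M by field_simp,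
      Complex.cos_two_pi_sub]

/-! ### The branches of the linear problem -/

section Branch

variable {M : ℕ} {K : ℂ} {n : ℕ} {f φs : Fin n → ℂ}

theorem curve_neg (K φ : ℂ) : (DeltaStar K φ - 1) * (Delta K φ - 1) = 1 + K :=
  (mul_comm _ _).trans (Delta_curve K φ)

/-- The solution of the linear problem of the branch `φ`. -/
theorem linSol_branch (h : Generic M K) (hφ : ∀ k, φs k ∈ allowedPhases M)
    (hinj : Function.Injective φs) {φ : ℂ} (hz : ∀ k, DeltaStar K φ ≠ DeltaStar K (φs k)) :
    LinSol K (Lam K φ) (tau K n f φs) (Theta K n f φs)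
      (fun m => (Delta K φ)⁻¹ ^ m * tau K n (fun k => f k * sFun K (φs k) φ) φs m)
      (fun m => Delta K φ * (DeltaStar K φ - 1) *
        ((Delta K φ)⁻¹ ^ m * Theta K n (fun k => f k * sFun K (φs k) φ) φs m)) := by
  rw [Lam, mul_comm (Delta K φ)]
  exact linSol_shift h hφ hinj (Delta_ne_zero h.ne_zero φ) (curve_neg K φ) hz

/-- The solution of the linear problem of the branch `-φ`. -/
theorem linSol_branch_neg (h : Generic M K) (hφ : ∀ k, φs k ∈ allowedPhases M)
    (hinj : Function.Injective φs) {φ : ℂ} (hz : ∀ k, Delta K φ ≠ DeltaStar K (φs k)) :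
    LinSol K (Lam K φ) (tau K n f φs) (Theta K n f φs)
      (fun m => (DeltaStar K φ)⁻¹ ^ m * tau K n (fun k => f k * sFun K (φs k) (-φ)) φs m)
      (fun m => DeltaStar K φ * (Delta K φ - 1) *
        ((DeltaStar K φ)⁻¹ ^ m * Theta K n (fun k => f k * sFun K (φs k) (-φ)) φs m)) := by
  have := linSol_branch (f := f) (φ := -φ) h hφ hinj (by rwa [DeltaStar_neg])
  rwa [Lam_neg, Delta_neg, DeltaStar_neg] at this

theorem branch_det_ne_zero (h : Generic M K) (hφ : ∀ k, φs k ∈ allowedPhases M)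
    (hinj : Function.Injective φs) {φ : ℂ} (hz : ∀ k, DeltaStar K φ ≠ DeltaStar K (φs k))
    (hz' : ∀ k, Delta K φ ≠ DeltaStar K (φs k)) (hne : Delta K φ ≠ DeltaStar K φ)
    (hT : tau K n f φs 0 ≠ 0) (hΘ : Theta K n f φs 0 ≠ 0) :
    (Delta K φ)⁻¹ ^ 0 * tau K n (fun k => f k * sFun K (φs k) φ) φs 0 *
        ((DeltaStar K φ)⁻¹ ^ 1 * tau K n (fun k => f k * sFun K (φs k) (-φ)) φs 1) -
      (Delta K φ)⁻¹ ^ 1 * tau K n (fun k => f k * sFun K (φs k) φ) φs 1 *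
        ((DeltaStar K φ)⁻¹ ^ 0 * tau K n (fun k => f k * sFun K (φs k) (-φ)) φs 0) ≠ 0 := by
  have hD := Delta_ne_zero h.ne_zero φ
  have hD' := DeltaStar_ne_zero h.ne_zero φ
  have := casoratian_inv_pow (f := f) h hφ hinj (curve_neg K φ) hD' hD hz hz'
  rw [shiftAmp_DeltaStar, shiftAmp_Delta] at this
  rw [this]
  exact mul_ne_zero (sub_ne_zero.2 hne) (div_ne_zero (mul_ne_zero hT hΘ) (mul_ne_zero hD' hD))

theorem branch_coeff_ne_zero (h : Generic M K) (φ : ℂ) :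
    Delta K φ * (DeltaStar K φ - 1) ≠ 0 ∧ DeltaStar K φ * (Delta K φ - 1) ≠ 0 :=
  ⟨mul_ne_zero (Delta_ne_zero h.ne_zero φ) (sub_ne_zero.2 (DeltaStar_ne_one h.one_add φ)),
    mul_ne_zero (DeltaStar_ne_zero h.ne_zero φ) (sub_ne_zero.2 (Delta_ne_one h.one_add φ))⟩

/-- Interaction with a soliton of phase ψ changes the branch ψ into -ψ. Hence adding that soliton
adds a multiple of the other branch. -/
theorem phaseShift_mul_sFun {φ ψ : ℂ} (h1 : DeltaStar K ψ ≠ Delta K φ)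
    (h2 : DeltaStar K ψ ≠ DeltaStar K φ) :
    sFun K φ ψ * phaseShift K φ ψ = sFun K φ (-ψ) := by
  have := vertex_ne_zero h1 h2
  rw [sFun_eq, sFun_eq, phaseShift_eq, DeltaStar_neg]
  field_simp

theorem tau_snoc (f φs : Fin n → ℂ) (f' φ : ℂ) (m : ℕ) :
    tau K (n + 1) (Fin.snoc (α := fun _ => ℂ) f f') (Fin.snoc (α := fun _ => ℂ) φs φ) m =
      tau K n f φs m + f' * Complex.exp (2 * Complex.I * φ) ^ m *
        tau K n (fun k => f k * phaseShift K (φs k) φ) φs m := by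
  rw [tau, ← Complex.exp_nat_mul]
  simp only [Fin.snoc_last, Fin.snoc_castSucc, mul_comm (phaseShift _ _ _)]
  congr 4
  ring

theorem Theta_snoc (f φs : Fin n → ℂ) (f' φ : ℂ) (m : ℕ) :
    Theta K (n + 1) (Fin.snoc (α := fun _ => ℂ) f f') (Fin.snoc (α := fun _ => ℂ) φs φ) m =
      Theta K n f φs m + cFun K φ * f' * Complex.exp (2 * Complex.I * φ) ^ m *
        Theta K n (fun k => f k * phaseShift K (φs k) φ) φs m := by
  rw [Theta, tau, ← Complex.exp_nat_mul]
  simp only [Fin.snoc_last, Fin.snoc_castSucc, mul_comm (phaseShift _ _ _), Theta, mul_assoc]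
  congr 4
  ring_nf

/-- The combination of the two branches corresponds to the creation of a soliton. -/
theorem creation_eq (h : Generic M K) {φ : ℂ} (h1 : ∀ k, DeltaStar K φ ≠ Delta K (φs k))
    (h2 : ∀ k, DeltaStar K φ ≠ DeltaStar K (φs k)) (f' : ℂ) (m : ℕ) :
    (Delta K φ)⁻¹ ^ m * tau K (n + 1)
        (Fin.snoc (α := fun _ => ℂ) (fun k => f k * sFun K (φs k) φ) f')
        (Fin.snoc (α := fun _ => ℂ) φs φ) m =
      (Delta K φ)⁻¹ ^ m * tau K n (fun k => f k * sFun K (φs k) φ) φs m +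
        f' * ((DeltaStar K φ)⁻¹ ^ m * tau K n (fun k => f k * sFun K (φs k) (-φ)) φs m) ∧
    Delta K φ * (DeltaStar K φ - 1) * ((Delta K φ)⁻¹ ^ m * Theta K (n + 1)
        (Fin.snoc (α := fun _ => ℂ) (fun k => f k * sFun K (φs k) φ) f')
        (Fin.snoc (α := fun _ => ℂ) φs φ) m) =
      Delta K φ * (DeltaStar K φ - 1) *
        ((Delta K φ)⁻¹ ^ m * Theta K n (fun k => f k * sFun K (φs k) φ) φs m) +
      f' * (DeltaStar K φ * (Delta K φ - 1) *
        ((DeltaStar K φ)⁻¹ ^ m * Theta K n (fun k => f k * sFun K (φs k) (-φ)) φs m)) := by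
  have hD := Delta_ne_zero h.ne_zero φ
  have hD' := DeltaStar_ne_zero h.ne_zero φ
  have hS : 1 - DeltaStar K φ ≠ 0 := sub_ne_zero.2 (DeltaStar_ne_one h.one_add φ).symm
  have hs : (fun k => f k * sFun K (φs k) φ * phaseShift K (φs k) φ) =
      fun k => f k * sFun K (φs k) (-φ) := by
    funext k
    rw [mul_assoc, phaseShift_mul_sFun (h1 k) (h2 k)]
  have he : (Delta K φ)⁻¹ ^ m * Complex.exp (2 * Complex.I * φ) ^ m = (DeltaStar K φ)⁻¹ ^ m := by
    rw [← Delta_div_DeltaStar h.ne_zero, ← mul_pow]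
    congr 1
    field_simp
  -- The function c(φ) is exactly the ratio of the normalizations of `R` on the two branches, so one
  -- amplitude `f'` serves both T and Θ.
  have hc : Delta K φ * (DeltaStar K φ - 1) * cFun K φ = DeltaStar K φ * (Delta K φ - 1) := by
    rw [cFun]
    field_simp
    ring
  rw [tau_snoc, Theta_snoc, hs, ← he, ← hc]
  constructor <;> ring

end Branch

/-! ### The cyclic Darboux transformation of a soliton state -/

section Main

variable {N M : ℕ} {κ : ℂ}

/-- Every quasi-periodic solution is a combination of the two independent branches, and the ratio of
the coefficients is the amplitude of the new soliton. -/
theorem cyclicDarboux_creation (hN : 0 < N) (hκ : κ ≠ 0) (h : Generic M (κ ^ N)) {n : ℕ}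
    {f φs : Fin n → ℂ} (s : SolitonState N M κ f φs) {φ : ℂ} (hφ : φ ∈ allowedPhases M)
    (hne : ∀ k, φ ≠ φs k) (u' w' : Fin M → ℂ) :
    CyclicDarboux N M κ φ s.u s.w u' w' ↔
      (∃ (f' : ℂ) (s' : SolitonState N M κ
          (Fin.snoc (α := fun _ => ℂ) (fun k => f k * sFun (κ ^ N) (φs k) φ) f')
          (Fin.snoc (α := fun _ => ℂ) φs φ)), InState u' w' s') ∨
      (∃ s' : SolitonState N M κ (fun k => f k * sFun (κ ^ N) (φs k) (-φ)) φs,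
        InStateUpToGauge (DeltaStar (κ ^ N) φ / Delta (κ ^ N) φ) u' w' s') := by
  have hD := Delta_ne_zero h.ne_zero φ
  have hD' := DeltaStar_ne_zero h.ne_zero φ
  have hz : ∀ k, DeltaStar (κ ^ N) φ ≠ DeltaStar (κ ^ N) (φs k) := fun k =>
    DeltaStar_ne_DeltaStar h hφ (s.phase_mem k) (hne k)
  have hz' : ∀ k, Delta (κ ^ N) φ ≠ DeltaStar (κ ^ N) (φs k) := fun k =>
    Delta_ne_DeltaStar h hφ (s.phase_mem k)
  have hz'' : ∀ k, DeltaStar (κ ^ N) φ ≠ Delta (κ ^ N) (φs k) := fun k =>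
    (Delta_ne_DeltaStar h (s.phase_mem k) hφ).symm
  have hlin := linSol_branch (f := f) h s.phase_mem s.phase_injective hz
  have hlin' := linSol_branch_neg (f := f) h s.phase_mem s.phase_injective hz'
  have hsnoc : ∀ f' : ℂ, LinSol (κ ^ N) (Lam (κ ^ N) φ) (tau (κ ^ N) n f φs)
      (Theta (κ ^ N) n f φs)
      (fun m => (Delta (κ ^ N) φ)⁻¹ ^ m * tau (κ ^ N) (n + 1)
        (Fin.snoc (α := fun _ => ℂ) (fun k => f k * sFun (κ ^ N) (φs k) φ) f')
        (Fin.snoc (α := fun _ => ℂ) φs φ) m)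
      (fun m => Delta (κ ^ N) φ * (DeltaStar (κ ^ N) φ - 1) *
        ((Delta (κ ^ N) φ)⁻¹ ^ m * Theta (κ ^ N) (n + 1)
        (Fin.snoc (α := fun _ => ℂ) (fun k => f k * sFun (κ ^ N) (φs k) φ) f')
        (Fin.snoc (α := fun _ => ℂ) φs φ) m)) := by
    intro f'
    simp only [fun m => (creation_eq (f := f) h hz'' hz f' m).1,
      fun m => (creation_eq (f := f) h hz'' hz f' m).2]
    exact hlin.add hlin' f'
  constructor
  · rw [cyclicDarboux_iff hN h.pos hκ s.tau_ne_zero s.Theta_ne_zero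
      (tau_add_period h.pos s.phase_mem) (Theta_add_period h.pos s.phase_mem)
      (neg_one_pow_mul_self N) (s.u_pow hN) s.w_pow]
    rintro ⟨P, R, μ, hPR0, hPR, hper, hst⟩
    obtain ⟨A, B, hAB⟩ := TauRec.span (Lam_ne_zero h.ne_zero φ) s.tau_ne_zero s.Theta_ne_zero
      hPR.tauRec hlin.tauRec hlin'.tauRec
      (branch_det_ne_zero h s.phase_mem s.phase_injective hz hz' (Delta_ne_DeltaStar_self h hφ)
        (s.tau_ne_zero 0) (s.Theta_ne_zero 0))
    -- The coefficients give f' = B / A, and `A = 0` is the limiting case f' = ∞. The gauge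
    -- multiplier Δ*/Δ there arises because the surviving branch grows like Δ*^(-m), while the
    -- formula for `u'` divides by Δ.
    by_cases hA : A = 0
    · right
      exact exists_state_of_linSol hN h.pos hD s.phase_mem s.phase_injective hD'
        (branch_coeff_ne_zero h φ).2 s.tau_ne_zero hlin' hPR0 hPR hper hst (A := B)
        (fun m => by rw [hAB, hA, zero_mul, zero_add])
    · left
      have hmem : ∀ k, (Fin.snoc (α := fun _ => ℂ) φs φ) k ∈ allowedPhases M := by
        intro k
        induction k using Fin.lastCases with
        | last => rwa [Fin.snoc_last]
        | cast k => rw [Fin.snoc_castSucc]; exact s.phase_mem k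
      have hinj : Function.Injective (Fin.snoc (α := fun _ => ℂ) φs φ) := by
        intro a b
        induction a using Fin.lastCases with
        | last =>
          induction b using Fin.lastCases with
          | last => exact fun _ => rfl
          | cast b =>
            rw [Fin.snoc_last, Fin.snoc_castSucc]
            exact fun hab => absurd hab (hne b)
        | cast a =>
          induction b using Fin.lastCases with
          | last =>
            rw [Fin.snoc_last, Fin.snoc_castSucc]
            exact fun hab => absurd hab.symm (hne a)
          | cast b =>
            rw [Fin.snoc_castSucc, Fin.snoc_castSucc]
            exact fun hab => congrArg _ (s.phase_injective hab)
      obtain ⟨s', hs'⟩ := exists_state_of_linSol hN h.pos hD hmem hinj hD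
        (branch_coeff_ne_zero h φ).1 s.tau_ne_zero (hsnoc (B / A)) hPR0 hPR hper hst (A := A)
        (fun m => by
          rw [hAB, (creation_eq (f := f) h hz'' hz (B / A) m).1]
          field_simp)
      exact ⟨B / A, s', inState_iff.2 (by rwa [div_self hD] at hs')⟩
  · rintro (⟨f', s', hs'⟩ | ⟨s', hs'⟩)
    · exact cyclicDarboux_of_state hN h.pos hκ s s' hD (branch_coeff_ne_zero h φ).1 (hsnoc f')
        (by rw [div_self hD]; exact inState_iff.1 hs')
    · exact cyclicDarboux_of_state hN h.pos hκ s s' hD' (branch_coeff_ne_zero h φ).2 hlin' hs'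

/-- The branches have distinct multipliers, so no proper mixture is quasi-periodic. The exception is
e^(2iφ) = 1, a branch point of the curve, where they coincide and `unique_at_branch_point` applies.
-/
theorem cyclicDarboux_generic (hN : 0 < N) (hκ : κ ≠ 0) (h : Generic M (κ ^ N)) {n : ℕ}
    {f φs : Fin n → ℂ} (s : SolitonState N M κ f φs) {φ : ℂ}
    (hφ : Complex.exp (2 * Complex.I * (M : ℂ) * φ) ≠ 1 ∨ Complex.exp (2 * Complex.I * φ) = 1)
    (u' w' : Fin M → ℂ) :
    CyclicDarboux N M κ φ s.u s.w u' w' ↔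
      (∃ s' : SolitonState N M κ (fun k => f k * sFun (κ ^ N) (φs k) φ) φs, InState u' w' s') ∨
      (∃ s' : SolitonState N M κ (fun k => f k * sFun (κ ^ N) (φs k) (-φ)) φs,
        InStateUpToGauge (DeltaStar (κ ^ N) φ / Delta (κ ^ N) φ) u' w' s') := by
  have hD := Delta_ne_zero h.ne_zero φ
  have hD' := DeltaStar_ne_zero h.ne_zero φ
  have hpow : Complex.exp (2 * Complex.I * (M : ℂ) * φ) = Complex.exp (2 * Complex.I * φ) ^ M := by
    rw [← Complex.exp_nat_mul]
    congr 1
    ring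
  have hexp : ∀ k, Complex.exp (2 * Complex.I * φ) ≠ Complex.exp (2 * Complex.I * φs k) := by
    intro k h0
    rcases hφ with hφ | hφ
    · exact hφ (by rw [hpow, h0, exp_allowed h.pos (s.phase_mem k)])
    · exact exp_allowed_ne_one (s.phase_mem k) (by rw [← h0, hφ])
  have hexp' : ∀ k, Complex.exp (2 * Complex.I * -φ) ≠ Complex.exp (2 * Complex.I * φs k) := by
    intro k h0
    have h1 : Complex.exp (2 * Complex.I * φ) * Complex.exp (2 * Complex.I * φs k) = 1 := by
      rw [← h0, ← Complex.exp_add, ← Complex.exp_zero]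
      congr 1
      ring
    rcases hφ with hφ | hφ
    · have h2 := congrArg (· ^ M) h1
      simp only [mul_pow, exp_allowed h.pos (s.phase_mem k), one_pow, mul_one] at h2
      exact hφ (by rw [hpow, h2])
    · rw [hφ, one_mul] at h1
      exact exp_allowed_ne_one (s.phase_mem k) h1
  have hz : ∀ k, DeltaStar (κ ^ N) φ ≠ DeltaStar (κ ^ N) (φs k) := fun k h0 =>
    hexp k (exp_eq_of_Delta_eq h.ne_zero h.one_add
      (curve_unique h.one_add (curve_neg _ _) (curve_neg _ _) h0))
  have hz' : ∀ k, Delta (κ ^ N) φ ≠ DeltaStar (κ ^ N) (φs k) := fun k h0 =>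
    hexp' k (exp_eq_of_Delta_eq h.ne_zero h.one_add
      (by rw [Delta_neg]
          exact curve_unique h.one_add (Delta_curve _ _) (curve_neg _ _) h0))
  have hlin := linSol_branch (f := f) h s.phase_mem s.phase_injective hz
  have hlin' := linSol_branch_neg (f := f) h s.phase_mem s.phase_injective hz'
  constructor
  · rw [cyclicDarboux_iff hN h.pos hκ s.tau_ne_zero s.Theta_ne_zero
      (tau_add_period h.pos s.phase_mem) (Theta_add_period h.pos s.phase_mem)
      (neg_one_pow_mul_self N) (s.u_pow hN) s.w_pow]
    rintro ⟨P, R, μ, hPR0, hPR, hper, hst⟩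
    have hcases : (∃ A : ℂ, ∀ m, P m = A * ((Delta (κ ^ N) φ)⁻¹ ^ m *
          tau (κ ^ N) n (fun k => f k * sFun (κ ^ N) (φs k) φ) φs m)) ∨
        ∃ B : ℂ, ∀ m, P m = B * ((DeltaStar (κ ^ N) φ)⁻¹ ^ m *
          tau (κ ^ N) n (fun k => f k * sFun (κ ^ N) (φs k) (-φ)) φs m) := by
      by_cases h1 : Complex.exp (2 * Complex.I * φ) = 1
      · left
        have hDD : DeltaStar (κ ^ N) φ = Delta (κ ^ N) φ := by
          rw [Delta_eq_exp_mul, h1, one_mul]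
        have hcos : Complex.cos φ ^ 2 + κ ^ N ≠ 0 := by
          have hsin : Complex.cos φ ^ 2 = 1 := by
            have h2 : Complex.cos (2 * φ) = 1 := by
              rw [Complex.cos, show 2 * φ * Complex.I = 2 * Complex.I * φ by ring, h1,
                show -(2 * φ) * Complex.I = -(2 * Complex.I * φ) by ring, Complex.exp_neg, h1]
              norm_num
            rw [Complex.cos_sq, h2]
            norm_num
          rw [hsin]
          exact h.one_add
        have hcurve := Delta_curve (κ ^ N) φ
        have hLam := Lam_add_ne_zero h.ne_zero hcos
        have hrec := hPR.tauRec
        rw [Lam, hDD] at hLam hrec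
        rw [hDD] at hcurve
        have := unique_at_branch_point h s.phase_mem s.phase_injective s.tau_ne_zero
          s.Theta_ne_zero hD hcurve hLam hz' hrec (fun i => (hper i).1)
        nth_rewrite 2 [← hDD] at this
        rwa [shiftAmp_DeltaStar] at this
      · have hDD : Delta (κ ^ N) φ ≠ DeltaStar (κ ^ N) φ := fun h0 => h1 (by
          rw [← Delta_div_DeltaStar h.ne_zero, h0, div_self hD'])
        have hM1 := hφ.resolve_right h1
        refine TauRec.of_ne_multiplier (Lam_ne_zero h.ne_zero φ) s.tau_ne_zero s.Theta_ne_zero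
          hPR.tauRec hlin.tauRec hlin'.tauRec
          (branch_det_ne_zero h s.phase_mem s.phase_injective hz hz' hDD
            (s.tau_ne_zero 0) (s.Theta_ne_zero 0)) (fun i => (hper i).1)
          (μ₁ := (Delta (κ ^ N) φ)⁻¹ ^ M) (μ₂ := (DeltaStar (κ ^ N) φ)⁻¹ ^ M)
          (fun i => ?_) (fun i => ?_) ?_
        · rw [tau_add_period h.pos s.phase_mem]; ring
        · rw [tau_add_period h.pos s.phase_mem]; ring
        · intro h0
          rw [inv_pow, inv_pow, inv_inj] at h0
          apply hM1
          rw [hpow, ← Delta_div_DeltaStar h.ne_zero, div_pow, h0,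
            div_self (pow_ne_zero _ hD')]
    rcases hcases with ⟨A, hA⟩ | ⟨B, hB⟩
    · left
      obtain ⟨s', hs'⟩ := exists_state_of_linSol hN h.pos hD s.phase_mem s.phase_injective hD
        (branch_coeff_ne_zero h φ).1 s.tau_ne_zero hlin hPR0 hPR hper hst hA
      exact ⟨s', inState_iff.2 (by rwa [div_self hD] at hs')⟩
    · right
      exact exists_state_of_linSol hN h.pos hD s.phase_mem s.phase_injective hD'
        (branch_coeff_ne_zero h φ).2 s.tau_ne_zero hlin' hPR0 hPR hper hst hB
  · rintro (⟨s', hs'⟩ | ⟨s', hs'⟩)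
    · exact cyclicDarboux_of_state hN h.pos hκ s s' hD (branch_coeff_ne_zero h φ).1 hlin
        (by rw [div_self hD]; exact inState_iff.1 hs')
    · exact cyclicDarboux_of_state hN h.pos hκ s s' hD' (branch_coeff_ne_zero h φ).2 hlin' hs'

/-- The linear problem depends on φ only through Λ(φ), so φ = φ_j and φ = -φ_j share one argument.
The unique quasi-periodic solution is the shift by Δ(φ_j), which removes soliton `j`; the sign of φ
affects only the gauge multiplier. -/
theorem cyclicDarboux_annihilation (hN : 0 < N) (hκ : κ ≠ 0) (h : Generic M (κ ^ N)) {n : ℕ}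
    {f φs : Fin (n + 1) → ℂ} (s : SolitonState N M κ f φs) (j : Fin (n + 1)) (hfj : f j ≠ 0)
    {φ : ℂ} (hφ : Lam (κ ^ N) φ = Lam (κ ^ N) (φs j)) (u' w' : Fin M → ℂ) :
    CyclicDarboux N M κ φ s.u s.w u' w' ↔
      ∃ s' : SolitonState N M κ
          (fun k : Fin n => f (j.succAbove k) * sFun (κ ^ N) (φs (j.succAbove k)) (-φs j))
          (fun k : Fin n => φs (j.succAbove k)),
        InStateUpToGauge (DeltaStar (κ ^ N) (φs j) / Delta (κ ^ N) φ) u' w' s' := by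
  have hD := Delta_ne_zero h.ne_zero φ
  have hDj' := DeltaStar_ne_zero h.ne_zero (φs j)
  have hq : ∀ k, Delta (κ ^ N) (φs j) ≠ DeltaStar (κ ^ N) (φs k) := fun k =>
    Delta_ne_DeltaStar h (s.phase_mem j) (s.phase_mem k)
  have hamp : (fun k : Fin n => f (j.succAbove k) *
      sFun (κ ^ N) (φs (j.succAbove k)) (-φs j)) =
      fun k => shiftAmp (κ ^ N) f φs (Delta (κ ^ N) (φs j)) (j.succAbove k) := by
    rw [shiftAmp_Delta]
  have hmem : ∀ k : Fin n, φs (j.succAbove k) ∈ allowedPhases M := fun k => s.phase_mem _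
  have hinj : Function.Injective fun k : Fin n => φs (j.succAbove k) :=
    s.phase_injective.comp Fin.succAbove_right_injective
  have hlin := linSol_shift (f := f) h s.phase_mem s.phase_injective hDj'
    (Delta_curve (κ ^ N) (φs j)) hq
  rw [← Lam, ← hφ] at hlin
  simp only [tau_eq_of_zero _ φs (shiftAmp_self f φs j),
    Theta_eq_of_zero _ φs (shiftAmp_self f φs j)] at hlin
  rw [hamp]
  constructor
  · rw [cyclicDarboux_iff hN h.pos hκ s.tau_ne_zero s.Theta_ne_zero
      (tau_add_period h.pos s.phase_mem) (Theta_add_period h.pos s.phase_mem)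
      (neg_one_pow_mul_self N) (s.u_pow hN) s.w_pow]
    rintro ⟨P, R, μ, hPR0, hPR, hper, hst⟩
    have hrec := hPR.tauRec
    rw [hφ] at hrec
    obtain ⟨A, hA⟩ := unique_at_soliton h s.phase_mem s.phase_injective s.tau_ne_zero
      s.Theta_ne_zero j hfj hrec (fun i => (hper i).1)
    simp only [tau_eq_of_zero _ φs (shiftAmp_self f φs j)] at hA
    exact exists_state_of_linSol hN h.pos hD hmem hinj hDj'
      (branch_coeff_ne_zero h (φs j)).2 s.tau_ne_zero hlin hPR0 hPR hper hst hA
  · rintro ⟨s', hs'⟩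
    exact cyclicDarboux_of_state hN h.pos hκ s s' hDj' (branch_coeff_ne_zero h (φs j)).2 hlin hs'

end Main

end RelToda

end

/-! ### Assembly of the cases -/

theorem proposition3 (N M : ℕ) (hN : 0 < N) (hM : 0 < M) (κ : ℂ) (hκ : κ ≠ 0)
    (hgen : ∀ j : ℕ, j < M →
      Complex.cos ((j : ℂ) * (Real.pi : ℂ) / (M : ℂ)) ^ 2 + κ ^ N ≠ 0) :
    -- (a) creation of a soliton
    (∀ (n : ℕ) (f φs : Fin n → ℂ) (s : RelToda.SolitonState N M κ f φs) (φ : ℂ),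
      φ ∈ RelToda.allowedPhases M → (∀ k, φ ≠ φs k) →
      ∀ u' w' : Fin M → ℂ,
        RelToda.CyclicDarboux N M κ φ s.u s.w u' w' ↔
          (∃ (f' : ℂ) (s' : RelToda.SolitonState N M κ
              (Fin.snoc (α := fun _ => ℂ)
                (fun k => f k * RelToda.sFun (κ ^ N) (φs k) φ) f')
              (Fin.snoc (α := fun _ => ℂ) φs φ)),
            RelToda.InState u' w' s') ∨
          (∃ s' : RelToda.SolitonState N M κ
              (fun k => f k * RelToda.sFun (κ ^ N) (φs k) (-φ)) φs,
            RelToda.InStateUpToGauge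
              (RelToda.DeltaStar (κ ^ N) φ / RelToda.Delta (κ ^ N) φ) u' w' s')) ∧
    -- (b) no soliton is created
    (∀ (n : ℕ) (f φs : Fin n → ℂ) (s : RelToda.SolitonState N M κ f φs) (φ : ℂ),
      (Complex.exp (2 * Complex.I * (M : ℂ) * φ) ≠ 1 ∨ Complex.exp (2 * Complex.I * φ) = 1) →
      ∀ u' w' : Fin M → ℂ,
        RelToda.CyclicDarboux N M κ φ s.u s.w u' w' ↔
          (∃ s' : RelToda.SolitonState N M κ
              (fun k => f k * RelToda.sFun (κ ^ N) (φs k) φ) φs,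
            RelToda.InState u' w' s') ∨
          (∃ s' : RelToda.SolitonState N M κ
              (fun k => f k * RelToda.sFun (κ ^ N) (φs k) (-φ)) φs,
            RelToda.InStateUpToGauge
              (RelToda.DeltaStar (κ ^ N) φ / RelToda.Delta (κ ^ N) φ) u' w' s')) ∧
    -- (c) annihilation of the soliton `j`, with `φ = -φ_j`
    (∀ (n : ℕ) (f φs : Fin (n + 1) → ℂ) (s : RelToda.SolitonState N M κ f φs)
      (j : Fin (n + 1)), f j ≠ 0 →
      RelToda.sFun (κ ^ N) (φs j) (-φs j) = 0 ∧
      ∀ u' w' : Fin M → ℂ,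
        RelToda.CyclicDarboux N M κ (-φs j) s.u s.w u' w' ↔
          ∃ s' : RelToda.SolitonState N M κ
              (fun k : Fin n => f (j.succAbove k) *
                RelToda.sFun (κ ^ N) (φs (j.succAbove k)) (-φs j))
              (fun k : Fin n => φs (j.succAbove k)),
            RelToda.InState u' w' s') ∧
    -- (d) annihilation of the soliton `j`, with `φ = φ_j`
    (∀ (n : ℕ) (f φs : Fin (n + 1) → ℂ) (s : RelToda.SolitonState N M κ f φs)
      (j : Fin (n + 1)), f j ≠ 0 →
      ∀ u' w' : Fin M → ℂ,
        RelToda.CyclicDarboux N M κ (φs j) s.u s.w u' w' ↔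
          ∃ s' : RelToda.SolitonState N M κ
              (fun k : Fin n => f (j.succAbove k) *
                RelToda.sFun (κ ^ N) (φs (j.succAbove k)) (φs j) *
                RelToda.phaseShift (κ ^ N) (φs (j.succAbove k)) (φs j))
              (fun k : Fin n => φs (j.succAbove k)),
            RelToda.InStateUpToGauge
              (RelToda.DeltaStar (κ ^ N) (φs j) / RelToda.Delta (κ ^ N) (φs j)) u' w' s') ∧
    -- every nonzero value of `Λ_φ` is covered by these cases
    (∀ Λφ : ℂ, Λφ ≠ 0 → ∃ φ : ℂ, RelToda.Lam (κ ^ N) φ = Λφ ∧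
      (φ ∈ RelToda.allowedPhases M ∨ Complex.exp (2 * Complex.I * (M : ℂ) * φ) ≠ 1 ∨
        Complex.exp (2 * Complex.I * φ) = 1)) := by
  have h : RelToda.Generic M (κ ^ N) := ⟨hM, pow_ne_zero N hκ, hgen⟩
  refine ⟨fun n f φs s φ hφ hne u' w' =>
      RelToda.cyclicDarboux_creation hN hκ h s hφ hne u' w',
    fun n f φs s φ hφ u' w' => RelToda.cyclicDarboux_generic hN hκ h s hφ u' w',
    fun n f φs s j hfj => ⟨?_, fun u' w' => ?_⟩, fun n f φs s j hfj u' w' => ?_,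
    fun Λφ hΛ => RelToda.exists_phase_of_Lam hM hΛ⟩
  · rw [RelToda.sFun_eq, RelToda.DeltaStar_neg, RelToda.vertex, sub_self, zero_div, mul_zero]
  -- For φ = -φ_j the gauge multiplier Δ*(φ_j)/Δ(φ) equals 1.
  · rw [RelToda.cyclicDarboux_annihilation hN hκ h s j hfj (RelToda.Lam_neg _ _) u' w',
      RelToda.Delta_neg, div_self (RelToda.DeltaStar_ne_zero h.ne_zero _)]
    exact exists_congr fun s' => RelToda.inState_iff.symm
  -- The product s(φ_k, φ_j) d(φ_k, φ_j) is s(φ_k, -φ_j), so the remaining amplitudes are those of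
  -- the case φ = -φ_j.
  · have hamp : (fun k : Fin n => f (j.succAbove k) *
        RelToda.sFun (κ ^ N) (φs (j.succAbove k)) (φs j) *
        RelToda.phaseShift (κ ^ N) (φs (j.succAbove k)) (φs j)) =
        fun k => f (j.succAbove k) * RelToda.sFun (κ ^ N) (φs (j.succAbove k)) (-φs j) := by
      funext k
      rw [mul_assoc, RelToda.phaseShift_mul_sFun
        (RelToda.Delta_ne_DeltaStar h (s.phase_mem _) (s.phase_mem _)).symm
        (RelToda.DeltaStar_ne_DeltaStar h (s.phase_mem _) (s.phase_mem _)
          fun h0 => (j.succAbove_ne k).symm (s.phase_injective h0))]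
    rw [hamp]
    exact RelToda.cyclicDarboux_annihilation hN hκ h s j hfj rfl u' w'
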